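/- A *finite directed graph* is a finite nonempty set $V$ with a binary edge relation $E$, and FO denotes first-order logic in the vocabulary $\{E\}$ with equality. *Unbounded depth.* Let $\varphi(P,v_1,\dots,v_r,v_{r+1},\dots,v_s)$ be a first-order formula in the vocabulary $\{E,P\}$ in which the $r$-ary predicate $P$ occurs only positively. For a finite directed graph $G$ and parameters $a_{r+1},\dots,a_s\in V(G)$ put $P_0=\emptyset$ and $P_{i+1}=\{(v_1,\dots,v_r) : G\models\varphi(P_i,v_1,\dots,v_r,a_{r+1},\dots,a_s)\}$. A set $\mathcal J$ of finite directed graphs *admits fixed points of unbounded depth* if for some such $\varphi$ there is no $j\in\mathbb N$ such that $P_j=\bigcup_i P_i$ for all $G\in\mathcal J$ and all parameters in $G$. *Logics.* Expand a directed graph with $n$ vertices to a two-sorted structure whose second sort is the set of numbers $\{0,\dots,n-1\}$ with the usual order. (FO+COUNT+LFP) is the closure of the atomic formulas (edges and equality between vertices, order and equality between numbers, relation variables over tuples of vertices and numbers) under Boolean connectives, quantification over vertices and over numbers, counting quantifiers $(\exists^{\ge i}x)\,\varphi$ ("there are at least $i$ vertices $x$ with $\varphi$", $i$ a number variable), and the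 least fixed point operator, applied to formulas positive in a relation variable over tuples of vertices and numbers. $(L+\mathrm{COUNT})^\omega_{\infty\omega}$ is built from the atomic formulas without relation variables by negation, conjunctions and disjunctions of arbitrary families of formulas, quantification over vertices and over numbers, and counting quantifiers $(\exists^{\ge i}x)$ with $i$ a number variable or a fixed natural number, where each formula contains only finitely many variables, free or bound. In both logics consider the formulas all of whose free variables are vertex variables. Such a formula is *first-order expressible on* $\mathcal J$ if there is one FO formula that is equivalent to it in every $G\in\mathcal J$ for all values of the free variables. **Theorem.** 1. There is a set $\mathcal J=\{J_1,J_2,\dots\}$ of finite directed graphs that admits fixed points of unbounded depth and on which FO = (FO+COUNT+LFP), that is, every formula of (FO+COUNT+LFP) is first-order expressible on $\mathcal J$. 2. For every countable set $\mathcal S$ of formulas of $(L+\mathrm{COUNT})^\omega_{\infty\omega}$ there is a set $\mathcal J=\{J_1,J_2,\dots\}$ of finite directed graphs that admits fixed points of unbounded depth and on which every formula of $\mathcal S$ is first-order expressible. -/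

import Mathlib

open FirstOrder

/-- A finite directed graph: a finite nonempty vertex set with an arbitrary binary edge relation. -/
structure FinDigraph where
  V : Type
  [fin : Finite V]
  [nonempty : Nonempty V]
  graph : Digraph V

namespace FinDigraph

attribute [instance] FinDigraph.fin FinDigraph.nonempty

/-- The number sort `{0, …, n - 1}`, where `n` is the number of vertices. -/
abbrev Num (G : FinDigraph) : Type := Fin (Nat.card G.V)

/-- A directed graph as a first-order structure with one binary relation symbol. -/
instance graphStructure (G : FinDigraph) : Language.graph.Structure G.V where
  RelMap := fun {_} R v =>
    match R, v with
    | .adj, v => G.graph.Adj (v 0) (v 1)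

end FinDigraph

/-! ### Positive elementary inductions -/

/-- The relation symbols `E` (binary) and `P` (`r`-ary). -/
inductive GraphPredRel (r : ℕ) : ℕ → Type
  | adj : GraphPredRel r 2
  | pred : GraphPredRel r r

/-- The vocabulary of graphs together with an additional `r`-ary predicate `P`. -/
def graphPredLang (r : ℕ) : Language := ⟨fun _ => Empty, GraphPredRel r⟩

/-- The expansion of the directed graph `G` by the interpretation `P` of the predicate. -/
abbrev FinDigraph.expand (G : FinDigraph) {r : ℕ} (P : Set (Fin r → G.V)) :
    (graphPredLang r).Structure G.V where
  funMap := fun f _ => f.elim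
  RelMap := fun {_} R v =>
    match R, v with
    | .adj, v => G.graph.Adj (v 0) (v 1)
    | .pred, v => v ∈ P

/-- An atomic formula with this relation symbol, in a place of polarity `b`, is no negative
occurrence of `P`. -/
def GraphPredRel.Allowed {r : ℕ} (b : Bool) : {n : ℕ} → GraphPredRel r n → Prop
  | _, .adj => True
  | _, .pred => b = true

/-- All occurrences of `P` in the formula have polarity `b` (`true`: all are positive, `false`: all
are negative). -/
def PredPolarity {r : ℕ} {α : Type} :
    Bool → {n : ℕ} → (graphPredLang r).BoundedFormula α n → Prop
  | _, _, .falsum => True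
  | _, _, .equal _ _ => True
  | b, _, .rel R _ => GraphPredRel.Allowed (r := r) b R
  | b, _, .imp φ ψ => PredPolarity (!b) φ ∧ PredPolarity b ψ
  | b, _, .all φ => PredPolarity b φ

/-- The operator `P ↦ {v | G ⊨ φ(P, v, a)}` of a first-order formula `φ` whose free variables are
`v` (the `r` variables on the left) and the parameters `a` (the `s` variables on the right). -/
def FinDigraph.inductionStep (G : FinDigraph) {r s : ℕ}
    (φ : (graphPredLang r).Formula (Fin r ⊕ Fin s)) (a : Fin s → G.V)
    (P : Set (Fin r → G.V)) : Set (Fin r → G.V) :=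
  {v | @Language.Formula.Realize (graphPredLang r) G.V (G.expand P) _ φ (Sum.elim v a)}

/-- The stages `P_0 = ∅`, `P_{i+1} = {v | G ⊨ φ(P_i, v, a)}`. -/
def FinDigraph.stage (G : FinDigraph) {r s : ℕ}
    (φ : (graphPredLang r).Formula (Fin r ⊕ Fin s)) (a : Fin s → G.V) (i : ℕ) :
    Set (Fin r → G.V) :=
  (G.inductionStep φ a)^[i] ∅

/-- The induction given by `φ` is bounded in `K`: some `j` has `P_j = ⋃ i, P_i` for all graphs in
`K` and all parameters. -/
def InductionBoundedOn (K : Set FinDigraph) {r s : ℕ}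
    (φ : (graphPredLang r).Formula (Fin r ⊕ Fin s)) : Prop :=
  ∃ j : ℕ, ∀ G ∈ K, ∀ a : Fin s → G.V, G.stage φ a j = ⋃ i, G.stage φ a i

/-- `K` admits fixed points of unbounded depth: some positive elementary induction is not bounded
in `K`. -/
def AdmitsUnboundedFixedPoints (K : Set FinDigraph) : Prop :=
  ∃ (r s : ℕ) (φ : (graphPredLang r).Formula (Fin r ⊕ Fin s)),
    PredPolarity true φ ∧ ¬ InductionBoundedOn K φ

/-! ### First-order logic with counting and least fixed points

The logic speaks about two-sorted structures: the vertices with the edge relation, and the numbers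
`{0, …, n - 1}` with their order. -/

/-- Formulas of `FO + COUNT + LFP` over directed graphs. `FPC Γ k l` are the expressions with free
vertex variables `Fin k`, free number variables `Fin l`, and free relation variables listed in `Γ`,
where `(r, q)` stands for a relation between `r` vertices and `q` numbers. A quantifier binds the
last variable of the larger context. Positivity is imposed by `FPC.WellFormed`. -/
inductive FPC : List (ℕ × ℕ) → ℕ → ℕ → Type
  | adj {Γ : List (ℕ × ℕ)} {k l : ℕ} (x y : Fin k) : FPC Γ k l
  | eq {Γ : List (ℕ × ℕ)} {k l : ℕ} (x y : Fin k) : FPC Γ k l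
  | numLe {Γ : List (ℕ × ℕ)} {k l : ℕ} (i j : Fin l) : FPC Γ k l
  | numEq {Γ : List (ℕ × ℕ)} {k l : ℕ} (i j : Fin l) : FPC Γ k l
  | rel {Γ : List (ℕ × ℕ)} {k l : ℕ} (X : Fin Γ.length)
      (xs : Fin (Γ.get X).1 → Fin k) (is : Fin (Γ.get X).2 → Fin l) : FPC Γ k l
  | neg {Γ : List (ℕ × ℕ)} {k l : ℕ} (φ : FPC Γ k l) : FPC Γ k l
  | and {Γ : List (ℕ × ℕ)} {k l : ℕ} (φ ψ : FPC Γ k l) : FPC Γ k l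
  /-- there is a vertex -/
  | ex {Γ : List (ℕ × ℕ)} {k l : ℕ} (φ : FPC Γ (k + 1) l) : FPC Γ k l
  /-- there is a number -/
  | numEx {Γ : List (ℕ × ℕ)} {k l : ℕ} (φ : FPC Γ k (l + 1)) : FPC Γ k l
  /-- there are at least `i` vertices -/
  | count {Γ : List (ℕ × ℕ)} {k l : ℕ} (i : Fin l) (φ : FPC Γ (k + 1) l) : FPC Γ k l
  /-- the tuple `(xs, is)` is in the least fixed point of `φ`, which defines a relation between the
  last `r` vertex variables and the last `q` number variables -/
  | lfp {Γ : List (ℕ × ℕ)} {k l : ℕ} (r q : ℕ) (φ : FPC ((r, q) :: Γ) (k + r) (l + q))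
      (xs : Fin r → Fin k) (is : Fin q → Fin l) : FPC Γ k l

namespace FPC

/-- All free occurrences of the relation variable `X` have polarity `b`. -/
def Polarity : {Γ : List (ℕ × ℕ)} → {k l : ℕ} → FPC Γ k l → Bool → Fin Γ.length → Prop
  | _, _, _, .adj _ _, _, _ => True
  | _, _, _, .eq _ _, _, _ => True
  | _, _, _, .numLe _ _, _, _ => True
  | _, _, _, .numEq _ _, _, _ => True
  | _, _, _, .rel Y _ _, b, X => Y = X → b = true
  | _, _, _, .neg φ, b, X => Polarity φ (!b) X
  | _, _, _, .and φ ψ, b, X => Polarity φ b X ∧ Polarity ψ b X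
  | _, _, _, .ex φ, b, X => Polarity φ b X
  | _, _, _, .numEx φ, b, X => Polarity φ b X
  | _, _, _, .count _ φ, b, X => Polarity φ b X
  | _, _, _, .lfp _ _ φ _ _, b, X => Polarity φ b X.succ

/-- The fixed-point operator is applied only to formulas in which the relation variable that it
binds has positive occurrences only. -/
def WellFormed : {Γ : List (ℕ × ℕ)} → {k l : ℕ} → FPC Γ k l → Prop
  | _, _, _, .adj _ _ => True
  | _, _, _, .eq _ _ => True
  | _, _, _, .numLe _ _ => True
  | _, _, _, .numEq _ _ => True
  | _, _, _, .rel _ _ _ => True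
  | _, _, _, .neg φ => WellFormed φ
  | _, _, _, .and φ ψ => WellFormed φ ∧ WellFormed ψ
  | _, _, _, .ex φ => WellFormed φ
  | _, _, _, .numEx φ => WellFormed φ
  | _, _, _, .count _ φ => WellFormed φ
  | _, _, _, .lfp _ _ φ _ _ => Polarity φ true (0 : Fin (_ + 1)) ∧ WellFormed φ

/-- Interpretations of the relation variables in `Γ`. -/
abbrev RelAssignment (G : FinDigraph) (Γ : List (ℕ × ℕ)) : Type :=
  (X : Fin Γ.length) → Set ((Fin (Γ.get X).1 → G.V) × (Fin (Γ.get X).2 → G.Num))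

/-- Interpret the newest relation variable by `P`. -/
def RelAssignment.cons {G : FinDigraph} {Γ : List (ℕ × ℕ)} {r q : ℕ}
    (P : Set ((Fin r → G.V) × (Fin q → G.Num))) (ρ : RelAssignment G Γ) :
    RelAssignment G ((r, q) :: Γ)
  | ⟨0, _⟩ => P
  | ⟨n + 1, h⟩ => ρ ⟨n, Nat.lt_of_succ_lt_succ h⟩

/-- Truth of a formula in `G`, with relation variables interpreted by `ρ`, vertex variables by `a`
and number variables by `ν`. The fixed point is the union of the stages that start with `∅`. -/
def Realize (G : FinDigraph) : {Γ : List (ℕ × ℕ)} → {k l : ℕ} → FPC Γ k l →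
    RelAssignment G Γ → (Fin k → G.V) → (Fin l → G.Num) → Prop
  | _, _, _, .adj x y, _, a, _ => G.graph.Adj (a x) (a y)
  | _, _, _, .eq x y, _, a, _ => a x = a y
  | _, _, _, .numLe i j, _, _, ν => ν i ≤ ν j
  | _, _, _, .numEq i j, _, _, ν => ν i = ν j
  | _, _, _, .rel X xs is, ρ, a, ν => (a ∘ xs, ν ∘ is) ∈ ρ X
  | _, _, _, .neg φ, ρ, a, ν => ¬ Realize G φ ρ a ν
  | _, _, _, .and φ ψ, ρ, a, ν => Realize G φ ρ a ν ∧ Realize G ψ ρ a ν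
  | _, _, _, .ex φ, ρ, a, ν => ∃ v : G.V, Realize G φ ρ (Fin.snoc a v) ν
  | _, _, _, .numEx φ, ρ, a, ν => ∃ m : G.Num, Realize G φ ρ a (Fin.snoc ν m)
  | _, _, _, .count i φ, ρ, a, ν =>
      (ν i : ℕ) ≤ {v : G.V | Realize G φ ρ (Fin.snoc a v) ν}.ncard
  | _, _, _, .lfp _ _ φ xs is, ρ, a, ν =>
      (a ∘ xs, ν ∘ is) ∈ ⋃ n : ℕ,
        (fun P => {p | Realize G φ (RelAssignment.cons P ρ)
          (Fin.append a p.1) (Fin.append ν p.2)})^[n] ∅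

end FPC

/-- A formula of `FO + COUNT + LFP` whose free variables are `m` vertex variables. -/
structure FPCFormula (m : ℕ) where
  formula : FPC [] m 0
  wellFormed : formula.WellFormed

/-- `G ⊨ φ(a)`. -/
def FPCFormula.Realize {m : ℕ} (φ : FPCFormula m) (G : FinDigraph) (a : Fin m → G.V) : Prop :=
  φ.formula.Realize G (fun X => X.elim0) a Fin.elim0

/-! ### Infinitary logic with counting and finitely many variables -/

universe u

/-- Infinitary formulas with counting over directed graphs in which only the vertex variables
`Fin k` and the number variables `Fin l`, free or bound, occur. Universal quantifiers and infinite
conjunctions are obtained with negations. -/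
inductive LCount (k l : ℕ) : Type (u + 1)
  | adj (x y : Fin k) : LCount k l
  | eq (x y : Fin k) : LCount k l
  | numLe (i j : Fin l) : LCount k l
  | numEq (i j : Fin l) : LCount k l
  | neg (φ : LCount k l) : LCount k l
  /-- the disjunction of an arbitrary family of formulas -/
  | iSup (ι : Type u) (φ : ι → LCount k l) : LCount k l
  /-- there is a vertex `x` -/
  | ex (x : Fin k) (φ : LCount k l) : LCount k l
  /-- there is a number `i` -/
  | numEx (i : Fin l) (φ : LCount k l) : LCount k l
  /-- there are at least `i` vertices `x`, for a number variable `i` -/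
  | count (i : Fin l) (x : Fin k) (φ : LCount k l) : LCount k l
  /-- there are at least `m` vertices `x`, for a natural number `m` -/
  | countConst (m : ℕ) (x : Fin k) (φ : LCount k l) : LCount k l

namespace LCount

variable {k l : ℕ}

/-- The free number variables. -/
def freeNum : LCount.{u} k l → Set (Fin l)
  | .adj _ _ => ∅
  | .eq _ _ => ∅
  | .numLe i j => {i, j}
  | .numEq i j => {i, j}
  | .neg φ => φ.freeNum
  | .iSup _ φ => ⋃ t, (φ t).freeNum
  | .ex _ φ => φ.freeNum
  | .numEx i φ => φ.freeNum \ {i}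
  | .count i _ φ => insert i φ.freeNum
  | .countConst _ _ φ => φ.freeNum

/-- Truth of a formula in `G`, with vertex variables interpreted by `a` and number variables by
`ν`. -/
def Realize (G : FinDigraph) : LCount.{u} k l → (Fin k → G.V) → (Fin l → G.Num) → Prop
  | .adj x y, a, _ => G.graph.Adj (a x) (a y)
  | .eq x y, a, _ => a x = a y
  | .numLe i j, _, ν => ν i ≤ ν j
  | .numEq i j, _, ν => ν i = ν j
  | .neg φ, a, ν => ¬ φ.Realize G a ν
  | .iSup _ φ, a, ν => ∃ t, (φ t).Realize G a ν
  | .ex x φ, a, ν => ∃ v : G.V, φ.Realize G (Function.update a x v) ν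
  | .numEx i φ, a, ν => ∃ m : G.Num, φ.Realize G a (Function.update ν i m)
  | .count i x φ, a, ν =>
      (ν i : ℕ) ≤ {v : G.V | φ.Realize G (Function.update a x v) ν}.ncard
  | .countConst m x φ, a, ν =>
      m ≤ {v : G.V | φ.Realize G (Function.update a x v) ν}.ncard

end LCount

/-- A formula of infinitary logic with counting and finitely many variables, all of whose free
variables are vertex variables. -/
structure LCountFormula where
  /-- the number of vertex variables, free or bound -/
  vars : ℕ
  /-- the number of number variables -/
  numVars : ℕ
  formula : LCount.{u} vars numVars
  closed : formula.freeNum = ∅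

/-- `G ⊨ φ(a)`. Number variables are not free in `φ`, so their values are irrelevant and are all
taken to be `0`. -/
def LCountFormula.Realize (φ : LCountFormula.{u}) (G : FinDigraph) (a : Fin φ.vars → G.V) : Prop :=
  φ.formula.Realize G a (fun _ => ⟨0, Nat.card_pos⟩)

/-! ### First-order expressibility -/

/-- The `m`-ary global relation `ρ` is expressed on `K` by a first-order formula over graphs. -/
def FOExpressibleOn (K : Set FinDigraph) {m : ℕ}
    (ρ : (G : FinDigraph) → (Fin m → G.V) → Prop) : Prop :=
  ∃ ψ : Language.graph.Formula (Fin m), ∀ G ∈ K, ∀ a : Fin m → G.V, ψ.Realize a ↔ ρ G a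

/-!
Let `q 1, q 2, …` be invariant under games with finitely many pebbles; this covers all formulas of
both logics, and there are only countably many formulas of FO+COUNT+LFP. The graph number `n` has a
skeleton with points on levels `0, …, n`. The points of level `0` are labels, which name the
numbers below a bound by the bit relation, and the points of level `l > 0` code all tuples of points
of lower level of a certain length.

To each pair of a lower and a higher point several Cai–Fürer–Immerman gadgets are attached. Each of
them can be twisted or not, and a gadget of level `l` has more rows than the queries `q i` with
`i ≤ l` have pebbles. A first-order formula detects a twist, because the untwisted gadgets are the
ones with a clique that meets every row. The game for `q l`, on the other hand, cannot detect the
twists of the gadgets of level at least `l`, so that the truth value of `q l` at a tuple depends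
only on the twists below level `l` and on finitely many pieces of information about the tuple,
which are points of level below `l`.

The twists are therefore chosen by recursion on the level: those of level `l` store the truth table
of `q l`, point by point. In all but finitely many of the graphs a fixed first-order formula reads
this table, and the exceptional graphs are described up to isomorphism. The inductions are of
unbounded depth because the bit relation contains the arbitrarily long chains `0, 1, 2, 4, 16, …`.
-/

/-! ### Bijective pebble games -/

section Tuples

variable {α β ι : Type*} {m n : ℕ}

/-- The set of pairs of corresponding entries of two tuples: the position of a pebble game in which
exactly these pairs are pebbled. -/
def tuplePairs (a : ι → α) (a' : ι → β) : Set (α × β) :=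
  Set.range fun i => (a i, a' i)

theorem ncard_tuplePairs_le (a : Fin m → α) (a' : Fin m → β) : (tuplePairs a a').ncard ≤ m := by
  simpa [tuplePairs, Nat.card_coe_set_eq] using Finite.card_range_le fun i => (a i, a' i)

theorem tuplePairs_comp_subset {κ : Type*} (a : ι → α) (a' : ι → β) (f : κ → ι) :
    tuplePairs (a ∘ f) (a' ∘ f) ⊆ tuplePairs a a' :=
  Set.range_comp_subset_range f fun i => (a i, a' i)

theorem tuplePairs_update_subset [DecidableEq ι] (a : ι → α) (a' : ι → β) (x : ι) (v : α) (w : β) :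
    tuplePairs (Function.update a x v) (Function.update a' x w) ⊆
      insert (v, w) (tuplePairs a a') := by
  rintro _ ⟨i, rfl⟩
  obtain rfl | hi := eq_or_ne i x
  · simp
  · simp only [Function.update_of_ne hi]
    exact Set.mem_insert_of_mem _ ⟨i, rfl⟩

theorem tuplePairs_append (a : Fin m → α) (a' : Fin m → β) (b : Fin n → α) (b' : Fin n → β) :
    tuplePairs (Fin.append a b) (Fin.append a' b') = tuplePairs a a' ∪ tuplePairs b b' := by
  ext p
  constructor
  · rintro ⟨i, rfl⟩
    refine Fin.addCases (fun j => Or.inl ⟨j, ?_⟩) (fun j => Or.inr ⟨j, ?_⟩) i <;> simp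
  · rintro (⟨i, rfl⟩ | ⟨i, rfl⟩)
    exacts [⟨Fin.castAdd n i, by simp⟩, ⟨Fin.natAdd m i, by simp⟩]

theorem tuplePairs_snoc (a : Fin m → α) (a' : Fin m → β) (v : α) (w : β) :
    tuplePairs (Fin.snoc a v : Fin (m + 1) → α) (Fin.snoc a' w : Fin (m + 1) → β) =
      insert (v, w) (tuplePairs a a') := by
  ext p
  simp [tuplePairs, Fin.exists_fin_succ', or_comm, eq_comm]

end Tuples

theorem ncard_setOf_congr {α β : Type*} (σ : α ≃ β) {p : α → Prop} {p' : β → Prop}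
    (h : ∀ v, p v ↔ p' (σ v)) : {v | p v}.ncard = {v | p' v}.ncard :=
  Nat.card_congr (σ.subtypeEquiv h)

/-- A winning strategy for the duplicator in the bijective game with `k` pebbles on `G` and `H`,
given by a set of positions that the duplicator never has to leave. -/
structure IsBijectiveSystem (G H : FinDigraph) (k : ℕ) (I : Set (Set (G.V × H.V))) : Prop where
  eq_iff : ∀ s ∈ I, ∀ p ∈ s, ∀ p' ∈ s, (p.1 = p'.1 ↔ p.2 = p'.2)
  adj_iff : ∀ s ∈ I, ∀ p ∈ s, ∀ p' ∈ s, (G.graph.Adj p.1 p'.1 ↔ H.graph.Adj p.2 p'.2)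
  mono : ∀ s ∈ I, ∀ t ⊆ s, t ∈ I
  extend : ∀ s ∈ I, s.ncard < k → ∃ σ : G.V ≃ H.V, ∀ v, insert (v, σ v) s ∈ I

/-- A global relation on finite directed graphs that is invariant under the bijective game with
`width` pebbles. -/
structure PebbleQuery where
  arity : ℕ
  width : ℕ
  rel : (G : FinDigraph) → (Fin arity → G.V) → Prop
  invariant : ∀ (G H : FinDigraph) (I : Set (Set (G.V × H.V))), IsBijectiveSystem G H width I →
    ∀ (a : Fin arity → G.V) (a' : Fin arity → H.V), tuplePairs a a' ∈ I → (rel G a ↔ rel H a')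

namespace IsBijectiveSystem

variable {G H : FinDigraph} {k m : ℕ} {I : Set (Set (G.V × H.V))}
  {a : Fin m → G.V} {a' : Fin m → H.V}

theorem exists_equiv_insert (hI : IsBijectiveSystem G H k I) (ha : tuplePairs a a' ∈ I)
    (hm : m < k) : ∃ σ : G.V ≃ H.V, ∀ v, insert (v, σ v) (tuplePairs a a') ∈ I :=
  hI.extend _ ha ((ncard_tuplePairs_le a a').trans_lt hm)

theorem exists_equiv_update (hI : IsBijectiveSystem G H k I) (ha : tuplePairs a a' ∈ I)
    (hm : m < k) (x : Fin m) : ∃ σ : G.V ≃ H.V, ∀ v,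
      tuplePairs (Function.update a x v) (Function.update a' x (σ v)) ∈ I := by
  obtain ⟨σ, hσ⟩ := hI.exists_equiv_insert ha hm
  exact ⟨σ, fun v => hI.mono _ (hσ v) _ (tuplePairs_update_subset a a' x v _)⟩

theorem card_eq (hI : IsBijectiveSystem G H k I) (hk : 0 < k) (hne : I.Nonempty) :
    Nat.card G.V = Nat.card H.V := by
  obtain ⟨s, hs⟩ := hne
  obtain ⟨σ, -⟩ := hI.extend ∅ (hI.mono s hs ∅ s.empty_subset) (by simpa using hk)
  exact Nat.card_congr σ

theorem exists_num_iff (hI : IsBijectiveSystem G H k I) (hk : 0 < k) (hne : I.Nonempty)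
    {p : G.Num → Prop} {p' : H.Num → Prop}
    (h : ∀ (i : G.Num) (j : H.Num), (i : ℕ) = j → (p i ↔ p' j)) : (∃ i, p i) ↔ ∃ j, p' j :=
  (finCongr (hI.card_eq hk hne)).exists_congr fun i => h i _ rfl

/-- The composition with an isomorphism is a winning strategy with any number of pebbles. -/
theorem of_equiv (e : G.V ≃ H.V) (he : ∀ x y, G.graph.Adj x y ↔ H.graph.Adj (e x) (e y)) (k : ℕ) :
    IsBijectiveSystem G H k {s | ∀ p ∈ s, p.2 = e p.1} where
  eq_iff s hs p hp p' hp' := by rw [hs p hp, hs p' hp', e.apply_eq_iff_eq]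
  adj_iff s hs p hp p' hp' := by rw [hs p hp, hs p' hp', he]
  mono s hs t ht p hp := hs p (ht hp)
  extend s hs _ := ⟨e, fun v => by
    rintro p (rfl | hp)
    exacts [rfl, hs p hp]⟩

end IsBijectiveSystem

/-! ### Formulas with counting are invariant under bijective games -/

namespace LCount

variable {k l : ℕ} {G H : FinDigraph} {K : ℕ} {I : Set (Set (G.V × H.V))}

theorem realize_iff (φ : LCount.{u} k l) (hI : IsBijectiveSystem G H K I) (hK : k < K)
    {a : Fin k → G.V} {a' : Fin k → H.V} {ν : Fin l → G.Num} {ν' : Fin l → H.Num}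
    (ha : tuplePairs a a' ∈ I) (hν : ∀ i, (ν i : ℕ) = ν' i) :
    φ.Realize G a ν ↔ φ.Realize H a' ν' := by
  induction φ generalizing a a' ν ν' with
  | adj x y => exact hI.adj_iff _ ha (a x, a' x) ⟨x, rfl⟩ (a y, a' y) ⟨y, rfl⟩
  | eq x y => exact hI.eq_iff _ ha (a x, a' x) ⟨x, rfl⟩ (a y, a' y) ⟨y, rfl⟩
  | numLe i j => simp only [Realize, Fin.le_def, hν]
  | numEq i j => simp only [Realize, Fin.ext_iff, hν]
  | neg φ ih => exact not_congr (ih ha hν)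
  | iSup ι φ ih => exact exists_congr fun t => ih t ha hν
  | ex x φ ih =>
    obtain ⟨σ, hσ⟩ := hI.exists_equiv_update ha hK x
    exact σ.exists_congr fun v => ih (hσ v) hν
  | numEx i φ ih =>
    refine hI.exists_num_iff (k.zero_le.trans_lt hK) ⟨_, ha⟩ fun m m' hm => ih ha fun j => ?_
    obtain rfl | hj := eq_or_ne j i
    · simpa using hm
    · simpa [Function.update_of_ne hj] using hν j
  | count i x φ ih =>
    obtain ⟨σ, hσ⟩ := hI.exists_equiv_update ha hK x
    simp only [Realize, hν i]
    rw [ncard_setOf_congr σ (p' := fun v => φ.Realize H (Function.update a' x v) ν')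
      fun v => ih (hσ v) hν]
  | countConst m x φ ih =>
    obtain ⟨σ, hσ⟩ := hI.exists_equiv_update ha hK x
    simp only [Realize]
    rw [ncard_setOf_congr σ (p' := fun v => φ.Realize H (Function.update a' x v) ν')
      fun v => ih (hσ v) hν]

end LCount

/-- A formula of infinitary logic with counting as a pebble query. -/
def LCountFormula.toPebbleQuery (φ : LCountFormula.{u}) : PebbleQuery where
  arity := φ.vars
  width := φ.vars + 1
  rel := φ.Realize
  invariant _ _ _ hI _ _ ha := φ.formula.realize_iff hI φ.vars.lt_succ_self ha fun _ => rfl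

namespace FPC

/-- A number of pebbles for which the game preserves the formula. The fixed point operator needs no
additional pebbles, since its stages are compared only in positions that the game reaches. -/
def width : {Γ : List (ℕ × ℕ)} → {k l : ℕ} → FPC Γ k l → ℕ
  | _, _, _, .adj _ _ => 0
  | _, _, _, .eq _ _ => 0
  | _, _, _, .numLe _ _ => 0
  | _, _, _, .numEq _ _ => 0
  | _, _, _, .rel _ _ _ => 0
  | _, _, _, .neg φ => width φ
  | _, _, _, .and φ ψ => max (width φ) (width ψ)
  | _, k, _, .ex φ => max (width φ) (k + 1)
  | _, _, _, .numEx φ => max (width φ) 1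
  | _, k, _, .count _ φ => max (width φ) (k + 1)
  | _, _, _, .lfp _ _ φ _ _ => width φ

section Invariance

variable {G H : FinDigraph} {I : Set (Set (G.V × H.V))} {s t : Set (G.V × H.V)}

/-- Two relations between vertices and numbers agree along all extensions in `I` of the
position `s`. -/
def RelAgree (I : Set (Set (G.V × H.V))) (s : Set (G.V × H.V)) {r q : ℕ}
    (P : Set ((Fin r → G.V) × (Fin q → G.Num))) (P' : Set ((Fin r → H.V) × (Fin q → H.Num))) :
    Prop :=
  ∀ (b : Fin r → G.V) (b' : Fin r → H.V) (μ : Fin q → G.Num) (μ' : Fin q → H.Num),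
    s ∪ tuplePairs b b' ∈ I → (∀ i, (μ i : ℕ) = μ' i) → ((b, μ) ∈ P ↔ (b', μ') ∈ P')

theorem RelAgree.mono {r q : ℕ} {P : Set ((Fin r → G.V) × (Fin q → G.Num))}
    {P' : Set ((Fin r → H.V) × (Fin q → H.Num))} (hI : ∀ s ∈ I, ∀ t ⊆ s, t ∈ I) (hst : s ⊆ t)
    (h : RelAgree I s P P') : RelAgree I t P P' :=
  fun b b' μ μ' hb => h b b' μ μ' (hI _ hb _ (Set.union_subset_union_left _ hst))

theorem RelAgree.iterate {r q : ℕ}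
    {F : Set ((Fin r → G.V) × (Fin q → G.Num)) → Set ((Fin r → G.V) × (Fin q → G.Num))}
    {F' : Set ((Fin r → H.V) × (Fin q → H.Num)) → Set ((Fin r → H.V) × (Fin q → H.Num))}
    (h : ∀ P P', RelAgree I s P P' → RelAgree I s (F P) (F' P')) (n : ℕ) :
    RelAgree I s (F^[n] ∅) (F'^[n] ∅) := by
  induction n with
  | zero => exact fun _ _ _ _ _ _ => Iff.rfl
  | succ n ih =>
    rw [Function.iterate_succ_apply', Function.iterate_succ_apply']
    exact h _ _ ih

theorem RelAgree.cons {Γ : List (ℕ × ℕ)} {r q : ℕ} {P : Set ((Fin r → G.V) × (Fin q → G.Num))}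
    {P' : Set ((Fin r → H.V) × (Fin q → H.Num))} {ρ : RelAssignment G Γ} {ρ' : RelAssignment H Γ}
    (hP : RelAgree I s P P') (hρ : ∀ X, RelAgree I s (ρ X) (ρ' X)) :
    ∀ X, RelAgree I s (RelAssignment.cons P ρ X) (RelAssignment.cons P' ρ' X)
  | ⟨0, _⟩ => hP
  | ⟨X + 1, h⟩ => hρ ⟨X, Nat.lt_of_succ_lt_succ h⟩

theorem realize_iff {Γ : List (ℕ × ℕ)} {k l K : ℕ} (φ : FPC Γ k l) (hK : φ.width ≤ K)
    (hI : IsBijectiveSystem G H K I) {ρ : RelAssignment G Γ} {ρ' : RelAssignment H Γ}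
    {a : Fin k → G.V} {a' : Fin k → H.V} {ν : Fin l → G.Num} {ν' : Fin l → H.Num}
    (ha : tuplePairs a a' ∈ I) (hν : ∀ i, (ν i : ℕ) = ν' i)
    (hρ : ∀ X, RelAgree I (tuplePairs a a') (ρ X) (ρ' X)) :
    φ.Realize G ρ a ν ↔ φ.Realize H ρ' a' ν' := by
  have agree_snoc {Γ : List (ℕ × ℕ)} {k : ℕ} {ρ : RelAssignment G Γ} {ρ' : RelAssignment H Γ}
      {a : Fin k → G.V} {a' : Fin k → H.V}
      (hρ : ∀ X, RelAgree I (tuplePairs a a') (ρ X) (ρ' X)) (v : G.V) (w : H.V) (X) :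
      RelAgree I (tuplePairs (Fin.snoc a v : Fin (k + 1) → G.V) (Fin.snoc a' w : Fin (k + 1) → H.V))
        (ρ X) (ρ' X) :=
    (hρ X).mono hI.mono (by rw [tuplePairs_snoc]; exact Set.subset_insert _ _)
  induction φ with
  | adj x y => exact hI.adj_iff _ ha (a x, a' x) ⟨x, rfl⟩ (a y, a' y) ⟨y, rfl⟩
  | eq x y => exact hI.eq_iff _ ha (a x, a' x) ⟨x, rfl⟩ (a y, a' y) ⟨y, rfl⟩
  | numLe i j => simp only [Realize, Fin.le_def, hν]
  | numEq i j => simp only [Realize, Fin.ext_iff, hν]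
  | rel X xs is =>
    refine hρ X _ _ _ _ ?_ fun i => hν (is i)
    rwa [Set.union_eq_left.2 (tuplePairs_comp_subset a a' xs)]
  | neg φ ih => exact not_congr (ih hK ha hν hρ)
  | and φ ψ ihφ ihψ =>
    exact and_congr (ihφ (le_of_max_le_left hK) ha hν hρ) (ihψ (le_of_max_le_right hK) ha hν hρ)
  | ex φ ih =>
    obtain ⟨σ, hσ⟩ := hI.exists_equiv_insert ha (le_of_max_le_right hK)
    exact σ.exists_congr fun v =>
      ih (le_of_max_le_left hK) (by rw [tuplePairs_snoc]; exact hσ v) hν (agree_snoc hρ _ _)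
  | numEx φ ih =>
    refine hI.exists_num_iff (le_of_max_le_right hK) ⟨_, ha⟩ fun m m' hm =>
      ih (le_of_max_le_left hK) ha (Fin.lastCases ?_ fun i => ?_) hρ
    · simpa using hm
    · simpa using hν i
  | count i φ ih =>
    obtain ⟨σ, hσ⟩ := hI.exists_equiv_insert ha (le_of_max_le_right hK)
    simp only [Realize, hν i]
    rw [ncard_setOf_congr σ (p' := fun v => φ.Realize H ρ' (Fin.snoc a' v) ν') fun v =>
      ih (le_of_max_le_left hK) (by rw [tuplePairs_snoc]; exact hσ v) hν (agree_snoc hρ _ _)]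
  | lfp r q φ xs is ih =>
    simp only [Realize, Set.mem_iUnion]
    refine exists_congr fun n => RelAgree.iterate (I := I) (s := tuplePairs a a')
      (fun P P' hP b b' μ μ' hb hμ => ?_) n _ _ _ _ ?_ fun i => hν (is i)
    · refine ih hK (by rwa [tuplePairs_append]) (Fin.addCases (fun i => ?_) fun i => ?_) fun X =>
        (hP.cons hρ X).mono hI.mono (by rw [tuplePairs_append]; exact Set.subset_union_left)
      · simpa using hν i
      · simpa using hμ i
    · rwa [Set.union_eq_left.2 (tuplePairs_comp_subset a a' xs)]

end Invariance

/-- An injective numbering of the formulas. -/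
def code : {Γ : List (ℕ × ℕ)} → {k l : ℕ} → FPC Γ k l → ℕ
  | _, _, _, .adj x y => Nat.pair 0 (Encodable.encode (x, y))
  | _, _, _, .eq x y => Nat.pair 1 (Encodable.encode (x, y))
  | _, _, _, .numLe i j => Nat.pair 2 (Encodable.encode (i, j))
  | _, _, _, .numEq i j => Nat.pair 3 (Encodable.encode (i, j))
  | Γ, k, l, .rel X xs is => Nat.pair 4 (Encodable.encode
      (⟨X, xs, is⟩ : (X : Fin Γ.length) × (Fin (Γ.get X).1 → Fin k) × (Fin (Γ.get X).2 → Fin l)))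
  | _, _, _, .neg φ => Nat.pair 5 (code φ)
  | _, _, _, .and φ ψ => Nat.pair 6 (Nat.pair (code φ) (code ψ))
  | _, _, _, .ex φ => Nat.pair 7 (code φ)
  | _, _, _, .numEx φ => Nat.pair 8 (code φ)
  | _, _, _, .count i φ => Nat.pair 9 (Nat.pair (Encodable.encode i) (code φ))
  | _, k, l, .lfp r q φ xs is => Nat.pair 10 (Nat.pair (Encodable.encode
      (⟨r, q, xs, is⟩ : (r : ℕ) × (q : ℕ) × (Fin r → Fin k) × (Fin q → Fin l))) (code φ))

theorem code_injective {Γ : List (ℕ × ℕ)} {k l : ℕ} :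
    Function.Injective (code : FPC Γ k l → ℕ) := by
  intro φ
  induction φ with
  | lfp r q φ xs is ih =>
    intro ψ h
    cases ψ with
    | lfp r' q' φ' xs' is' =>
      simp only [code, Nat.pair_eq_pair, Encodable.encode_inj, true_and] at h
      obtain ⟨h, hφ⟩ := h
      cases h
      rw [ih hφ]
    | _ => exact absurd (Nat.pair_eq_pair.1 h).1 (by decide)
  | rel X xs is =>
    intro ψ h
    cases ψ with
    | rel X' xs' is' =>
      cases Encodable.encode_injective (Nat.pair_eq_pair.1 h).2
      rfl
    | _ => exact absurd (Nat.pair_eq_pair.1 h).1 (by decide)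
  | _ =>
    intro ψ h
    cases ψ <;> first
      | exact absurd (Nat.pair_eq_pair.1 h).1 (by decide)
      | simp only [code, Nat.pair_eq_pair, Encodable.encode_inj, Prod.mk.injEq, true_and] at h
        grind [Function.Injective]

instance (Γ : List (ℕ × ℕ)) (k l : ℕ) : Countable (FPC Γ k l) :=
  code_injective.countable

end FPC

instance (m : ℕ) : Countable (FPCFormula m) :=
  Function.Injective.countable (f := FPCFormula.formula) fun φ ψ h => by
    cases φ; cases ψ; simpa using h

/-- A formula of `FO + COUNT + LFP` as a pebble query. -/
def FPCFormula.toPebbleQuery {m : ℕ} (φ : FPCFormula m) : PebbleQuery where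
  arity := m
  width := φ.formula.width
  rel := φ.Realize
  invariant _ _ _ hI _ _ ha :=
    φ.formula.realize_iff le_rfl hI ha (fun i => i.elim0) fun X => X.elim0

/-! ### Uniform first-order definability in a family of graphs -/

/-- A relation on the graphs `J i` is defined by one first-order formula for all `i` along `l`. -/
def DefinableAlong {ι α : Type*} (l : Filter ι) (J : ι → FinDigraph)
    (ρ : (i : ι) → (α → (J i).V) → Prop) : Prop :=
  ∃ ψ : Language.graph.Formula α, ∀ᶠ i in l, ∀ a : α → (J i).V, ψ.Realize a ↔ ρ i a

namespace DefinableAlong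

variable {ι α : Type*} {l : Filter ι} {J : ι → FinDigraph}
  {ρ σ : (i : ι) → (α → (J i).V) → Prop}

theorem congr_eventually (h : DefinableAlong l J ρ)
    (e : ∀ᶠ i in l, ∀ a, ρ i a ↔ σ i a) : DefinableAlong l J σ := by
  obtain ⟨ψ, hψ⟩ := h
  refine ⟨ψ, ?_⟩
  filter_upwards [hψ, e] with i h₁ h₂ a
  rw [h₁, h₂]

theorem congr (h : DefinableAlong l J ρ) (e : ∀ i a, ρ i a ↔ σ i a) : DefinableAlong l J σ :=
  h.congr_eventually (Filter.Eventually.of_forall e)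

theorem adj (s t : α) : DefinableAlong l J fun i a => (J i).graph.Adj (a s) (a t) :=
  ⟨Language.Relations.formula₂ (L := Language.graph) .adj (.var s) (.var t),
    Filter.Eventually.of_forall fun _ _ => Language.Formula.realize_rel₂⟩

theorem eq (s t : α) : DefinableAlong l J fun _ a => a s = a t := by
  refine ⟨Language.Term.equal (.var s) (.var t), Filter.Eventually.of_forall fun i a => ?_⟩
  simp [Language.Formula.realize_equal]

theorem not (h : DefinableAlong l J ρ) : DefinableAlong l J fun i a => ¬ ρ i a := by
  obtain ⟨ψ, hψ⟩ := h
  refine ⟨.not ψ, hψ.mono fun i h a => ?_⟩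
  rw [Language.Formula.realize_not, h]

theorem and (h₁ : DefinableAlong l J ρ) (h₂ : DefinableAlong l J σ) :
    DefinableAlong l J fun i a => ρ i a ∧ σ i a := by
  obtain ⟨ψ, hψ⟩ := h₁
  obtain ⟨χ, hχ⟩ := h₂
  refine ⟨ψ ⊓ χ, (hψ.and hχ).mono fun i h a => ?_⟩
  rw [Language.Formula.realize_inf, h.1, h.2]

theorem or (h₁ : DefinableAlong l J ρ) (h₂ : DefinableAlong l J σ) :
    DefinableAlong l J fun i a => ρ i a ∨ σ i a :=
  (h₁.not.and h₂.not).not.congr fun _ _ => by tauto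

theorem imp (h₁ : DefinableAlong l J ρ) (h₂ : DefinableAlong l J σ) :
    DefinableAlong l J fun i a => ρ i a → σ i a :=
  (h₁.and h₂.not).not.congr fun _ _ => by tauto

theorem iff (h₁ : DefinableAlong l J ρ) (h₂ : DefinableAlong l J σ) :
    DefinableAlong l J fun i a => (ρ i a ↔ σ i a) :=
  ((h₁.imp h₂).and (h₂.imp h₁)).congr fun _ _ => by tauto

theorem forall_finite {κ : Type*} [Finite κ] {τ : κ → (i : ι) → (α → (J i).V) → Prop}
    (h : ∀ c, DefinableAlong l J (τ c)) : DefinableAlong l J fun i a => ∀ c, τ c i a := by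
  choose ψ hψ using h
  refine ⟨Language.Formula.iInf ψ, (Filter.eventually_all.2 hψ).mono fun i h a => ?_⟩
  rw [Language.Formula.realize_iInf]
  exact forall_congr' fun c => h c a

theorem exists_finite {κ : Type*} [Finite κ] {τ : κ → (i : ι) → (α → (J i).V) → Prop}
    (h : ∀ c, DefinableAlong l J (τ c)) : DefinableAlong l J fun i a => ∃ c, τ c i a :=
  (forall_finite fun c => (h c).not).not.congr fun _ _ => by push Not; rfl

theorem const (p : Prop) : DefinableAlong l J (α := α) fun _ _ => p := by
  by_cases hp : p
  · exact (forall_finite (κ := Empty) (τ := fun _ _ _ => False) fun c => c.elim).congr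
      fun _ _ => by simp [hp]
  · exact (forall_finite (κ := Empty) (τ := fun _ _ _ => False) fun c => c.elim).not.congr
      fun _ _ => by simp [hp]

theorem exists_tuple {κ : Type*} [Finite κ] {τ : (i : ι) → (α → (J i).V) → (κ → (J i).V) → Prop}
    (h : DefinableAlong l J fun i (c : α ⊕ κ → (J i).V) =>
      τ i (fun s => c (.inl s)) fun s => c (.inr s)) :
    DefinableAlong l J fun i a => ∃ x, τ i a x := by
  obtain ⟨ψ, hψ⟩ := h
  refine ⟨Language.Formula.iExs κ ψ, hψ.mono fun i h a => ?_⟩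
  rw [Language.Formula.realize_iExs]
  exact exists_congr fun x => h _

theorem ex {τ : (i : ι) → (α → (J i).V) → (J i).V → Prop}
    (h : DefinableAlong l J fun i (c : α ⊕ Unit → (J i).V) =>
      τ i (fun s => c (.inl s)) (c (.inr ()))) :
    DefinableAlong l J fun i a => ∃ x, τ i a x :=
  (exists_tuple (κ := Unit) (τ := fun i a x => τ i a (x ())) h).congr fun _ _ =>
    ⟨fun ⟨x, hx⟩ => ⟨x (), hx⟩, fun ⟨x, hx⟩ => ⟨fun _ => x, hx⟩⟩

theorem all {τ : (i : ι) → (α → (J i).V) → (J i).V → Prop}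
    (h : DefinableAlong l J fun i (c : α ⊕ Unit → (J i).V) =>
      τ i (fun s => c (.inl s)) (c (.inr ()))) :
    DefinableAlong l J fun i a => ∀ x, τ i a x :=
  (ex (τ := fun i a x => ¬ τ i a x) h.not).not.congr fun _ _ => by push Not; rfl

end DefinableAlong

/-! ### Finitely many exceptional graphs -/

/-- The map `x` is an isomorphism of directed graphs. It is given by a function rather than an
equivalence since a tuple of first-order variables indexed by the vertices of `G` is a function. -/
structure FinDigraph.IsIso {G H : FinDigraph} (x : G.V → H.V) : Prop where
  bijective : Function.Bijective x
  adj_iff : ∀ v w, G.graph.Adj v w ↔ H.graph.Adj (x v) (x w)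

theorem FinDigraph.isIso_id (G : FinDigraph) : IsIso (id : G.V → G.V) :=
  ⟨Function.bijective_id, fun _ _ => Iff.rfl⟩

theorem FinDigraph.definableAlong_isIso {ι α : Type*} {J : ι → FinDigraph} {l : Filter ι}
    (G : FinDigraph) (g : G.V → α) :
    DefinableAlong l J fun i (c : α → (J i).V) => IsIso (G := G) fun v => c (g v) := by
  have injective : DefinableAlong l J fun i (c : α → (J i).V) =>
      ∀ v w, c (g v) = c (g w) → v = w :=
    .forall_finite fun v => .forall_finite fun w => .imp (.eq _ _) (.const _)
  have surjective : DefinableAlong l J fun i (c : α → (J i).V) => ∀ y, ∃ v, c (g v) = y :=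
    .all (.exists_finite fun v => .eq (α := α ⊕ Unit) (.inl (g v)) (.inr ()))
  have preserves : DefinableAlong l J fun i (c : α → (J i).V) =>
      ∀ v w, G.graph.Adj v w ↔ (J i).graph.Adj (c (g v)) (c (g w)) :=
    .forall_finite fun v => .forall_finite fun w => .iff (.const _) (.adj _ _)
  exact ((injective.and surjective).and preserves).congr fun i c =>
    ⟨fun h => ⟨h.1, h.2⟩, fun h => ⟨h.bijective, h.adj_iff⟩⟩

namespace PebbleQuery

variable (q : PebbleQuery)

theorem rel_iff_of_isIso {G H : FinDigraph} {x : G.V → H.V} (hx : FinDigraph.IsIso x)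
    (a : Fin q.arity → G.V) : q.rel G a ↔ q.rel H (x ∘ a) := by
  refine q.invariant G H _ (.of_equiv (Equiv.ofBijective x hx.bijective) hx.adj_iff _) _ _ ?_
  rintro _ ⟨s, rfl⟩
  rfl

theorem rel_iff_exists_isIso {G H : FinDigraph} (h : ∃ x : G.V → H.V, FinDigraph.IsIso x)
    (a : Fin q.arity → H.V) :
    q.rel H a ↔ ∃ x : G.V → H.V, FinDigraph.IsIso x ∧ ∃ c, q.rel G c ∧ ∀ s, a s = x (c s) := by
  constructor
  · obtain ⟨x, hx⟩ := h
    intro ha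
    choose c hc using fun s => hx.bijective.surjective (a s)
    refine ⟨x, hx, c, (q.rel_iff_of_isIso hx c).2 ?_, fun s => (hc s).symm⟩
    rwa [show x ∘ c = a from funext hc]
  · rintro ⟨x, hx, c, hc, hac⟩
    rw [show a = x ∘ c from funext hac]
    exact (q.rel_iff_of_isIso hx c).1 hc

/-- A formula can list the isomorphism types of finitely many graphs and all values of the query
on them. -/
theorem definableAlong_top {ι : Type*} {J : ι → FinDigraph}
    (h : DefinableAlong Filter.cofinite J fun i => q.rel (J i)) :
    DefinableAlong ⊤ J fun i => q.rel (J i) := by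
  obtain ⟨ψ, hψ⟩ := h
  let A := {i | ¬ ∀ a : Fin q.arity → (J i).V, ψ.Realize a ↔ q.rel (J i) a}
  have : Finite A := Filter.eventually_cofinite.1 hψ
  have exceptional : DefinableAlong ⊤ J fun i (_ : Fin q.arity → (J i).V) =>
      ∃ j : A, ∃ x : (J j).V → (J i).V, FinDigraph.IsIso x :=
    .exists_finite fun j => .exists_tuple (FinDigraph.definableAlong_isIso (J j) _)
  have listed : DefinableAlong ⊤ J fun i (a : Fin q.arity → (J i).V) =>
      ∃ j : A, ∃ x : (J j).V → (J i).V, FinDigraph.IsIso x ∧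
        ∃ c, q.rel (J j) c ∧ ∀ s, a s = x (c s) := by
    refine .exists_finite fun j => .exists_tuple (.and (FinDigraph.definableAlong_isIso (J j) _) ?_)
    exact .exists_finite fun c => .and (.const _) (.forall_finite fun s =>
      .eq (α := Fin q.arity ⊕ (J j).V) (.inl s) (.inr (c s)))
  have generic : DefinableAlong ⊤ J fun i (a : Fin q.arity → (J i).V) => ψ.Realize a :=
    ⟨ψ, Filter.Eventually.of_forall fun _ _ => Iff.rfl⟩
  refine (listed.or (exceptional.not.and generic)).congr fun i a => ?_
  by_cases hi : ∃ j : A, ∃ x : (J j).V → (J i).V, FinDigraph.IsIso x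
  · simp only [hi, not_true_eq_false, false_and, or_false]
    refine ⟨fun ⟨j, x, hx⟩ => (q.rel_iff_exists_isIso ⟨x, hx.1⟩ a).2 ⟨x, hx⟩, fun ha => ?_⟩
    obtain ⟨j, hj⟩ := hi
    exact ⟨j, (q.rel_iff_exists_isIso hj a).1 ha⟩
  · have hiA : i ∉ A := fun h => hi ⟨⟨i, h⟩, id, (J i).isIso_id⟩
    simp only [hi, not_false_eq_true, true_and, not_not.1 hiA a, or_iff_right_iff_imp]
    exact fun ⟨j, x, hx, _⟩ => absurd ⟨j, x, hx⟩ hi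

theorem foExpressibleOn_range {J : ℕ → FinDigraph}
    (h : DefinableAlong Filter.atTop J fun n => q.rel (J n)) :
    FOExpressibleOn (Set.range J) q.rel := by
  obtain ⟨ψ, hψ⟩ := q.definableAlong_top (Nat.cofinite_eq_atTop ▸ h)
  exact ⟨ψ, Set.forall_mem_range.2 fun n => Filter.eventually_top.1 hψ n⟩

end PebbleQuery

/-! ### Skeletons -/

/-- Finitely many points on levels `0, …, height`. The points of level `0` are labels, and `lab s`
is the label with number `s < size`. Every tuple with `roles l` entries of level below `l` is coded
by a point `y` of level `l`, where `dec y t` is the entry with index `t`. -/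
structure LevelledSet (roles : ℕ → ℕ) (size height : ℕ) where
  B : Type
  [fin : Finite B]
  lev : B → ℕ
  num : B → ℕ
  lab : ℕ → B
  dec : B → ℕ → B
  lev_le : ∀ β, lev β ≤ height
  lev_lab : ∀ s, lev (lab s) = 0
  num_lab : ∀ s < size, num (lab s) = s
  num_lt : ∀ β, lev β = 0 → num β < size
  lab_num : ∀ β, lev β = 0 → lab (num β) = β
  exists_dec : ∀ l, 0 < l → l ≤ height → ∀ v : ℕ → B, (∀ t < roles l, lev (v t) < l) →
    ∃ y, lev y = l ∧ ∀ t < roles l, dec y t = v t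

attribute [instance] LevelledSet.fin

namespace LevelledSet

variable {roles : ℕ → ℕ} {size height : ℕ}

/-- The levelled set that consists of the labels only. -/
def labels (roles : ℕ → ℕ) (hs : 0 < size) : LevelledSet roles size 0 where
  B := Fin size
  lev _ := 0
  num β := β
  lab s := if h : s < size then ⟨s, h⟩ else ⟨0, hs⟩
  dec β _ := β
  lev_le _ := le_rfl
  lev_lab _ := rfl
  num_lab s h := by simp [h]
  num_lt β _ := β.2
  lab_num β _ := by simp
  exists_dec _ h₀ h₁ := absurd h₁ (Nat.not_le.2 h₀)

theorem exists_dec_sum (S : LevelledSet roles size height) {l : ℕ} (h₀ : 0 < l)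
    (h₁ : l ≤ height + 1) {v : ℕ → S.B ⊕ (Fin (roles (height + 1)) → S.B)}
    (hv : ∀ t < roles l, Sum.elim S.lev (fun _ => height + 1) (v t) < l) :
    ∃ y, Sum.elim S.lev (fun _ => height + 1) y = l ∧ ∀ t < roles l,
      (Sum.elim (fun β t => .inl (S.dec β t)) fun w t =>
        if h : t < roles (height + 1) then .inl (w ⟨t, h⟩) else .inl (S.lab 0) :
          S.B ⊕ (Fin (roles (height + 1)) → S.B) → ℕ → _) y t = v t := by
  have old : ∀ t, ∃ β, t < roles l → v t = .inl β ∧ S.lev β < l := by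
    intro t
    by_cases ht : t < roles l
    · have hvt := hv t ht
      cases h : v t with
      | inl β => exact ⟨β, fun _ => ⟨rfl, by simpa [h] using hvt⟩⟩
      | inr w => exact absurd (hvt.trans_le h₁) (by simp [h])
    · exact ⟨S.lab 0, fun h => absurd h ht⟩
  choose w hw using old
  rcases Nat.lt_or_ge l (height + 1) with hl | hl
  · obtain ⟨y, hy, hdec⟩ := S.exists_dec l h₀ (Nat.le_of_lt_succ hl) w fun t ht => (hw t ht).2
    exact ⟨.inl y, hy, fun t ht => by simp [hdec t ht, (hw t ht).1]⟩
  · obtain rfl : l = height + 1 := le_antisymm h₁ hl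
    exact ⟨.inr fun t => w t, rfl, fun t ht => by simp [ht, (hw t ht).1]⟩

/-- The extension of a levelled set by one level, which consists of the tuples of points. -/
def succ (S : LevelledSet roles size height) : LevelledSet roles size (height + 1) where
  B := S.B ⊕ (Fin (roles (height + 1)) → S.B)
  lev := Sum.elim S.lev fun _ => height + 1
  num := Sum.elim S.num fun _ => 0
  lab s := .inl (S.lab s)
  dec := Sum.elim (fun β t => .inl (S.dec β t)) fun w t =>
    if h : t < roles (height + 1) then .inl (w ⟨t, h⟩) else .inl (S.lab 0)
  lev_le := by
    rintro (β | v)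
    exacts [Nat.le_succ_of_le (S.lev_le β), le_rfl]
  lev_lab := S.lev_lab
  num_lab := S.num_lab
  num_lt := by
    rintro (β | v) h
    exacts [S.num_lt β h, absurd h (Nat.succ_ne_zero height)]
  lab_num := by
    rintro (β | v) h
    exacts [congrArg _ (S.lab_num β h), absurd h (Nat.succ_ne_zero height)]
  exists_dec _ h₀ h₁ _ hv := S.exists_dec_sum h₀ h₁ hv

theorem nonempty (roles : ℕ → ℕ) (hs : 0 < size) :
    (height : ℕ) → Nonempty (LevelledSet roles size height)
  | 0 => ⟨labels roles hs⟩
  | height + 1 => (nonempty roles hs height).map succ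

end LevelledSet

/-- A levelled set of labels and codes together with bounds for the sizes of the gadgets that are
attached to it. -/
structure Skeleton (roles rows : ℕ → ℕ) where
  height : ℕ
  bits : ℕ
  bound : ℕ
  levels : LevelledSet roles (2 ^ bits) height
  roles_le : ∀ l ≤ height, roles l ≤ bound
  rows_le : ∀ l ≤ height, rows l ≤ bound
  pair_lt : ∀ t < bound, ∀ r < bound, Nat.pair t r < bits
  height_lt : height < bits

theorem Skeleton.exists_height (roles rows : ℕ → ℕ) (n : ℕ) :
    ∃ S : Skeleton roles rows, S.height = n := by
  let P := ∑ l ∈ Finset.range (n + 1), (roles l + rows l)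
  obtain ⟨L⟩ := LevelledSet.nonempty roles (size := 2 ^ ((P + 1) ^ 2 + n + 1)) (by positivity) n
  have hP : ∀ l ≤ n, roles l + rows l ≤ P := fun l hl =>
    Finset.single_le_sum (f := fun l => roles l + rows l) (fun _ _ => Nat.zero_le _)
      (Finset.mem_range.2 (Nat.lt_succ_of_le hl))
  refine ⟨⟨n, (P + 1) ^ 2 + n + 1, P, L, ?_, ?_, ?_, ?_⟩, rfl⟩
  · exact fun l hl => le_trans (Nat.le_add_right _ _) (hP l hl)
  · exact fun l hl => le_trans (Nat.le_add_left _ _) (hP l hl)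
  · intro t ht r hr
    have h₁ := Nat.pair_lt_max_add_one_sq t r
    have h₂ : (max t r + 1) ^ 2 ≤ (P + 1) ^ 2 :=
      Nat.pow_le_pow_left (Nat.succ_le_succ (max_le ht.le hr.le)) 2
    omega
  · omega

/-! ### Gadgets -/

/-- The vertices of row `r` of a gadget with `κ` rows: vectors with even coordinate sum. -/
def IsRow {P : ℕ} (κ : ℕ) (r : Fin P) (u : Fin P → ZMod 2) : Prop :=
  u r = 0 ∧ (∀ s : Fin P, κ ≤ s → u s = 0) ∧ ∑ s, u s = 0

theorem IsRow.zero {P : ℕ} (κ : ℕ) (r : Fin P) : IsRow κ r 0 :=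
  ⟨rfl, fun _ _ => rfl, by simp⟩

theorem IsRow.add {P κ : ℕ} {r : Fin P} {u v : Fin P → ZMod 2} (hu : IsRow κ r u)
    (hv : IsRow κ r v) : IsRow κ r (u + v) := by
  refine ⟨by simp [hu.1, hv.1], fun s hs => by simp [hu.2.1 s hs, hv.2.1 s hs], ?_⟩
  simp [Finset.sum_add_distrib, hu.2.2, hv.2.2]

open Classical in
/-- The matrix that twists the edges between the first two rows if `p` holds. -/
noncomputable def twist {P : ℕ} (p : Prop) (r s : Fin P) : ZMod 2 :=
  if p ∧ ((r : ℕ) = 0 ∧ (s : ℕ) = 1 ∨ (r : ℕ) = 1 ∧ (s : ℕ) = 0) then 1 else 0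

theorem twist_comm {P : ℕ} (p : Prop) (r s : Fin P) : twist p r s = twist p s r := by
  unfold twist
  congr 1
  simp only [eq_iff_iff]
  tauto

namespace Skeleton

variable {roles rows : ℕ → ℕ} (S : Skeleton roles rows)

/-- The points of the skeleton. -/
abbrev B : Type := S.levels.B

/-- The level of a point. -/
abbrev lev (β : S.B) : ℕ := S.levels.lev β

/-- The number of a label. -/
abbrev num (β : S.B) : ℕ := S.levels.num β

/-- The label with a given number. -/
abbrev lab (s : ℕ) : S.B := S.levels.lab s

/-- A vertex of the gadget `(x, y, t)` in row `r`. -/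
@[ext]
structure GadgetVertex where
  x : S.B
  y : S.B
  t : Fin S.bound
  r : Fin S.bound
  u : Fin S.bound → ZMod 2
  lev_lt : S.lev x < S.lev y
  t_lt : (t : ℕ) < roles (S.lev y)
  r_lt : (r : ℕ) < rows (S.lev y)
  row : IsRow (rows (S.lev y)) r u

instance : Finite S.GadgetVertex :=
  Finite.of_injective
    (β := S.B × S.B × Fin S.bound × Fin S.bound × (Fin S.bound → ZMod 2))
    (fun v => (v.x, v.y, v.t, v.r, v.u)) fun v w h => by
      simp only [Prod.mk.injEq] at h
      exact GadgetVertex.ext h.1 h.2.1 h.2.2.1 h.2.2.2.1 h.2.2.2.2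

/-- The vertices are the points of the skeleton and the vertices of the gadgets. -/
abbrev Vertex : Type := S.B ⊕ S.GadgetVertex

/-- The edge relation, where `b x y t` tells whether the gadget `(x, y, t)` is twisted. A label is
joined to the labels in whose number it is a binary digit and to the points whose level it names,
every vertex but the labels has a loop, and a gadget is attached to `x` by ingoing edges, to `y` by
outgoing edges, and to the label that names role and row. -/
def Adj (b : S.B → S.B → ℕ → Prop) : S.Vertex → S.Vertex → Prop
  | .inl β, .inl γ => (S.lev β = 0 ∧ S.lev γ = 0 ∧ (S.num γ).testBit (S.num β) = true) ∨
      (S.lev β = 0 ∧ S.lev γ ≠ 0 ∧ S.num β = S.lev γ) ∨ (S.lev β ≠ 0 ∧ β = γ)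
  | .inl β, .inr v => β = v.x
  | .inr v, .inl β => β = v.y ∨ (S.lev β = 0 ∧ S.num β = Nat.pair v.t v.r)
  | .inr v, .inr w => v = w ∨ (v.x = w.x ∧ v.y = w.y ∧ v.t = w.t ∧ v.r ≠ w.r ∧
      v.u w.r + w.u v.r = twist (b v.x v.y v.t) v.r w.r)

/-- The directed graph on the skeleton and the gadgets. -/
abbrev graph (b : S.B → S.B → ℕ → Prop) : FinDigraph where
  V := S.Vertex
  nonempty := ⟨.inl (S.lab 0)⟩
  graph := ⟨S.Adj b⟩

theorem bits_lt_two_pow : S.bits < 2 ^ S.bits := Nat.lt_two_pow_self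

theorem num_lab {s : ℕ} (h : s < S.bits) : S.num (S.lab s) = s :=
  S.levels.num_lab s (h.trans S.bits_lt_two_pow)

theorem lab_inj {s d : ℕ} (hs : s < 2 ^ S.bits) (hd : d < 2 ^ S.bits) (h : S.lab s = S.lab d) :
    s = d := by
  rw [← S.levels.num_lab s hs, ← S.levels.num_lab d hd]
  exact congrArg _ h

theorem lev_lt_two_pow (β : S.B) : S.lev β < 2 ^ S.bits :=
  ((S.levels.lev_le β).trans_lt S.height_lt).trans S.bits_lt_two_pow

theorem one_lt_two_pow : 1 < 2 ^ S.bits :=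
  Nat.one_lt_two_pow (Nat.pos_of_ne_zero fun h => by have := S.height_lt; omega).ne'

theorem GadgetVertex.pair_lt {S : Skeleton roles rows} (v : S.GadgetVertex) :
    Nat.pair v.t v.r < S.bits :=
  S.pair_lt _ v.t.2 _ v.r.2

/-- The points of the skeleton to which a vertex is attached. -/
def coord : S.Vertex → Fin 3 → S.B
  | .inl β, _ => β
  | .inr v, c => ![v.x, v.y, S.lab (Nat.pair v.t v.r)] c

open Classical in
/-- The number that codes the set of all `Nat.pair t s` such that some vertex of role `t` in row `s`
distinguishes `v` and `w`. -/
noncomputable def diff (b : S.B → S.B → ℕ → Prop) (v w : S.Vertex) : ℕ :=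
  Nat.ofBits fun s : Fin S.bits => decide (∃ z : S.GadgetVertex, Nat.pair z.t z.r = s ∧
    ¬ (S.Adj b (.inr z) v ↔ S.Adj b (.inr z) w))

theorem diff_lt (b : S.B → S.B → ℕ → Prop) (v w : S.Vertex) : S.diff b v w < 2 ^ S.bits :=
  Nat.ofBits_lt_two_pow _

open Classical in
theorem testBit_diff (b : S.B → S.B → ℕ → Prop) (v w : S.Vertex) (s : ℕ) :
    (S.diff b v w).testBit s = true ↔ ∃ z : S.GadgetVertex, Nat.pair z.t z.r = s ∧
      ¬ (S.Adj b (.inr z) v ↔ S.Adj b (.inr z) w) := by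
  by_cases hs : s < S.bits
  · rw [diff, Nat.testBit_ofBits_lt _ _ hs, decide_eq_true_iff]
  · rw [diff, Nat.testBit_ofBits_ge _ _ (Nat.not_lt.1 hs)]
    simp only [Bool.false_eq_true, false_iff, not_exists, not_and]
    rintro z rfl
    exact absurd z.pair_lt hs

end Skeleton

/-- The pieces of information about a tuple of `m` vertices. -/
inductive Slot (m : ℕ) : Type
  | unit : Slot m
  | level (s : Fin m) (c : Fin 3) : Slot m
  | low (s : Fin m) (c : Fin 3) : Slot m
  | eq (s : Fin m) (c : Fin 3) (s' : Fin m) (c' : Fin 3) : Slot m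
  | adj (s s' : Fin m) : Slot m
  | diff (s s' : Fin m) : Slot m

instance (m : ℕ) : Finite (Slot m) :=
  Finite.of_surjective
    (α := Unit ⊕ (Fin m × Fin 3) ⊕ (Fin m × Fin 3) ⊕ ((Fin m × Fin 3) × Fin m × Fin 3) ⊕
      (Fin m × Fin m) ⊕ (Fin m × Fin m))
    (Sum.elim (fun _ => .unit) <| Sum.elim (fun p => .level p.1 p.2) <|
      Sum.elim (fun p => .low p.1 p.2) <| Sum.elim (fun p => .eq p.1.1 p.1.2 p.2.1 p.2.2) <|
      Sum.elim (fun p => .adj p.1 p.2) fun p => .diff p.1 p.2)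
    fun o => by cases o <;> simp

namespace Skeleton

variable {roles rows : ℕ → ℕ} (S : Skeleton roles rows)

open Classical in
/-- The information about the tuple `a` that matters on level `l`, as a tuple of points of level
below `l`. -/
noncomputable def info (b : S.B → S.B → ℕ → Prop) (l : ℕ) {m : ℕ} (a : Fin m → S.Vertex) :
    Slot m → S.B
  | .unit => S.lab 0
  | .level s c => S.lab (S.lev (S.coord (a s) c))
  | .low s c => if S.lev (S.coord (a s) c) < l then S.coord (a s) c else S.lab 0
  | .eq s c s' c' => S.lab (if S.coord (a s) c = S.coord (a s') c' then 1 else 0)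
  | .adj s s' => S.lab (if S.Adj b (a s) (a s') then 1 else 0)
  | .diff s s' => S.lab (S.diff b (a s) (a s'))

theorem lev_info_lt (b : S.B → S.B → ℕ → Prop) {l : ℕ} (hl : 0 < l) {m : ℕ}
    (a : Fin m → S.Vertex) (o : Slot m) : S.lev (S.info b l a o) < l := by
  cases o with
  | low s c =>
    simp only [info]
    split_ifs with h
    · exact h
    · exact (S.levels.lev_lab _).trans_lt hl
  | _ => exact (S.levels.lev_lab _).trans_lt hl

/-- Equality of the information about two tuples, in two graphs on the same vertices. -/
structure SameInfo (b b' : S.B → S.B → ℕ → Prop) (l : ℕ) {m : ℕ} (a a' : Fin m → S.Vertex) :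
    Prop where
  lev_eq : ∀ s c, S.lev (S.coord (a s) c) = S.lev (S.coord (a' s) c)
  low_eq : ∀ s c, S.lev (S.coord (a s) c) < l → S.coord (a s) c = S.coord (a' s) c
  eq_iff : ∀ s c s' c', S.coord (a s) c = S.coord (a s') c' ↔ S.coord (a' s) c = S.coord (a' s') c'
  adj_iff : ∀ s s', S.Adj b (a s) (a s') ↔ S.Adj b' (a' s) (a' s')
  diff_eq : ∀ s s', S.diff b (a s) (a s') = S.diff b' (a' s) (a' s')

open Classical in
theorem sameInfo_of_info_eq {b b' : S.B → S.B → ℕ → Prop} {l m : ℕ} {a a' : Fin m → S.Vertex}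
    (h : S.info b l a = S.info b' l a') : S.SameInfo b b' l a a' := by
  have flag : ∀ {p p' : Prop} [Decidable p] [Decidable p'],
      S.lab (if p then 1 else 0) = S.lab (if p' then 1 else 0) → (p ↔ p') := by
    intro p p' _ _ h
    have h1 := S.one_lt_two_pow
    have := S.lab_inj (by split_ifs <;> omega) (by split_ifs <;> omega) h
    by_cases hp : p <;> by_cases hp' : p' <;> simp_all
  have hlev : ∀ s c, S.lev (S.coord (a s) c) = S.lev (S.coord (a' s) c) := fun s c =>
    S.lab_inj (S.lev_lt_two_pow _) (S.lev_lt_two_pow _) (congrFun h (.level s c))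
  refine ⟨hlev, fun s c hs => ?_, fun s c s' c' => flag (congrFun h (.eq s c s' c')),
    fun s s' => flag (congrFun h (.adj s s')), fun s s' =>
    S.lab_inj (S.diff_lt _ _ _) (S.diff_lt _ _ _) (congrFun h (.diff s s'))⟩
  have := congrFun h (.low s c)
  simp only [info] at this
  rwa [if_pos hs, if_pos (hlev s c ▸ hs)] at this

end Skeleton

/-! ### Permutations of the levels -/

/-- The permutation respects the levels, and it is the identity below level `l`. -/
structure IsLevelwise {B : Type*} (lev : B → ℕ) (l : ℕ) (π : Equiv.Perm B) : Prop where
  lev_eq : ∀ β, lev (π β) = lev β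
  fix : ∀ β, lev β < l → π β = β

namespace IsLevelwise

variable {B ι : Type*} {lev : B → ℕ} {l : ℕ} {π : Equiv.Perm B}

theorem swap [DecidableEq B] {β γ : B} (hlev : lev β = lev γ) (hl : l ≤ lev β) :
    IsLevelwise lev l (Equiv.swap β γ) where
  lev_eq δ := by
    rw [Equiv.swap_apply_def]
    split_ifs with h h'
    exacts [h ▸ hlev.symm, h' ▸ hlev, rfl]
  fix δ hδ := by
    refine Equiv.swap_apply_of_ne_of_ne ?_ ?_ <;> rintro rfl <;> omega

theorem trans {π' : Equiv.Perm B} (h : IsLevelwise lev l π) (h' : IsLevelwise lev l π') :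
    IsLevelwise lev l (π.trans π') where
  lev_eq β := (h'.lev_eq _).trans (h.lev_eq β)
  fix β hβ := by rw [Equiv.trans_apply, h.fix β hβ, h'.fix β hβ]

theorem exists_apply_eq (h : IsLevelwise lev l π) {β γ : B} (hlev : lev β = lev γ)
    (hlow : lev β < l → β = γ) : ∃ π' : Equiv.Perm B, IsLevelwise lev l π' ∧ π' β = γ ∧
      ∀ δ, δ ≠ β → π δ ≠ γ → π' δ = π δ := by
  classical
  by_cases hl : lev β < l
  · exact ⟨π, h, (h.fix β hl).trans (hlow hl), fun _ _ _ => rfl⟩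
  · refine ⟨π.trans (Equiv.swap (π β) γ), h.trans (swap ((h.lev_eq β).trans hlev) ?_), ?_, ?_⟩
    · rw [h.lev_eq]
      exact Nat.not_lt.1 hl
    · simp
    · exact fun δ hβ hγ => Equiv.swap_apply_of_ne_of_ne (π.injective.ne hβ) hγ

theorem exists_extend [Finite ι] {p p' : ι → B} (hlev : ∀ i, lev (p i) = lev (p' i))
    (hlow : ∀ i, lev (p i) < l → p i = p' i) (heq : ∀ i j, p i = p j ↔ p' i = p' j) :
    ∃ π : Equiv.Perm B, IsLevelwise lev l π ∧ ∀ i, π (p i) = p' i := by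
  classical
  have := Fintype.ofFinite ι
  suffices ∀ A : Finset ι, ∃ π : Equiv.Perm B, IsLevelwise lev l π ∧ ∀ i ∈ A, π (p i) = p' i by
    simpa using this Finset.univ
  intro A
  induction A using Finset.induction_on with
  | empty => exact ⟨1, ⟨fun _ => rfl, fun _ _ => rfl⟩, by simp⟩
  | insert j A _ ih =>
    obtain ⟨π, hπ, hA⟩ := ih
    obtain ⟨π', hπ', hj, hne⟩ := hπ.exists_apply_eq (hlev j) (hlow j)
    refine ⟨π', hπ', fun i hi => ?_⟩
    by_cases hij : p i = p j
    · rw [hij, hj, (heq i j).1 hij]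
    · have hiA : i ∈ A := Finset.mem_of_mem_insert_of_ne hi fun h => hij (h ▸ rfl)
      rw [hne _ hij (hA i hiA ▸ fun h => hij ((heq i j).2 h)), hA i hiA]

end IsLevelwise

/-! ### Switching the rows of a gadget -/

section RowSwitch

variable {P κ : ℕ}

theorem exists_row_notMem (hκ : κ ≤ P) {T : Set (Fin P)} (hT : T.ncard < κ) :
    ∃ r : Fin P, (r : ℕ) < κ ∧ r ∉ T := by
  by_contra! h
  have hsub : Set.range (Fin.castLE hκ) ⊆ T := Set.range_subset_iff.2 fun i => h _ i.2
  have hcard := Set.ncard_le_ncard hsub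
  rw [← Set.image_univ, Set.ncard_image_of_injective _ (Fin.castLE_injective hκ),
    Set.ncard_univ, Nat.card_fin] at hcard
  omega

theorem sum_sum_eq_zero_of_add_swap_eq_zero {ι M : Type*} [AddCommMonoid M] (A : Finset ι)
    {f : ι → ι → M} (hdiag : ∀ i ∈ A, f i i = 0)
    (hswap : ∀ i ∈ A, ∀ j ∈ A, i ≠ j → f i j + f j i = 0) : ∑ i ∈ A, ∑ j ∈ A, f i j = 0 := by
  rw [← Finset.sum_product']
  refine Finset.sum_involution (fun p _ => p.swap) ?_ ?_ ?_ fun p _ => p.swap_swap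
  · rintro ⟨i, j⟩ h
    obtain ⟨hi, hj⟩ := Finset.mem_product.1 h
    obtain rfl | hij := eq_or_ne i j
    · simp [hdiag i hi]
    · exact hswap i hi j hj hij
  · rintro ⟨i, j⟩ h hne hs
    obtain rfl : j = i := congrArg Prod.fst hs
    exact hne (hdiag _ (Finset.mem_product.1 h).1)
  · exact fun p h => Finset.mem_product.2 (Finset.mem_product.1 h).symm

/-- Adding `f r` to the vectors of row `r`, for all rows `r` of a gadget with `κ` rows, changes the
edges of the gadget by the matrix `Δ`, except for edges at the rows in `Z`. -/
structure IsRowSwitch (κ : ℕ) (Δ : Fin P → Fin P → ZMod 2) (Z : Set (Fin P))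
    (f : Fin P → Fin P → ZMod 2) : Prop where
  row : ∀ r : Fin P, (r : ℕ) < κ → IsRow κ r (f r)
  pair : ∀ r s : Fin P, r ≠ s → (r : ℕ) < κ → (s : ℕ) < κ → r ∉ Z → s ∉ Z →
    f r s + f s r = Δ r s

theorem isRow_update_sum {r z : Fin P} (hzr : z ≠ r) (hz : (z : ℕ) < κ) {u : Fin P → ZMod 2}
    (hr : u r = 0) (hu : ∀ s : Fin P, κ ≤ s → u s = 0) :
    IsRow κ r (Function.update u z (∑ s ∈ Finset.univ.erase z, u s)) := by
  refine ⟨by rw [Function.update_of_ne hzr.symm, hr], fun s hs => ?_, ?_⟩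
  · rw [Function.update_of_ne (by rintro rfl; omega), hu s hs]
  · rw [← Finset.add_sum_erase _ _ (Finset.mem_univ z), Function.update_self,
      Finset.sum_congr rfl fun s hs => Function.update_of_ne (Finset.ne_of_mem_erase hs) _ _]
    exact CharTwo.add_self_eq_zero _

theorem IsRow.apply_eq_sum {r : Fin P} {u : Fin P → ZMod 2} (hu : IsRow κ r u) (z : Fin P) :
    u z = ∑ s with s ≠ z ∧ (s : ℕ) < κ, u s := by
  have hsum : ∑ s with s ≠ z ∧ (s : ℕ) < κ, u s = ∑ s ∈ Finset.univ.erase z, u s := by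
    refine Finset.sum_subset (fun s hs => by simp_all) fun s hs hs' => hu.2.1 s ?_
    by_contra hκ
    exact hs' (by simp_all)
  rw [hsum, ← CharTwo.add_eq_zero, Finset.add_sum_erase _ _ (Finset.mem_univ z), hu.2.2]

namespace IsRowSwitch

variable {Δ : Fin P → Fin P → ZMod 2}

/-- A switching prescribed in the rows of `O` extends to all rows if one row `z` may be defective:
the entries in column `z` make all row sums vanish. -/
theorem exists_extend {O : Set (Fin P)} {f₀ : Fin P → Fin P → ZMod 2}
    (hΔ : ∀ r s, Δ r s = Δ s r) (hrow : ∀ r ∈ O, IsRow κ r (f₀ r))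
    (hpair : ∀ r ∈ O, ∀ s ∈ O, r ≠ s → f₀ r s + f₀ s r = Δ r s) {z : Fin P} (hz : z ∉ O)
    (hzκ : (z : ℕ) < κ) : ∃ f, (∀ r ∈ O, f r = f₀ r) ∧ IsRowSwitch κ Δ {z} f := by
  classical
  let h : Fin P → Fin P → ZMod 2 := fun r s => if s = r ∨ κ ≤ s then 0 else
    if s ∈ O then Δ r s + f₀ s r else if r < s then Δ r s else 0
  let f : Fin P → Fin P → ZMod 2 := fun r => if r ∈ O then f₀ r else if r = z then 0 else
    Function.update (h r) z (∑ s ∈ Finset.univ.erase z, h r s)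
  have f_of_mem : ∀ r ∈ O, f r = f₀ r := fun r hr => by simp [f, hr]
  have f_of_notMem : ∀ r ∉ O, r ≠ z → ∀ s ≠ z, f r s = h r s := fun r hr hrz s hs => by
    simp [f, hr, hrz, hs]
  refine ⟨f, f_of_mem, fun r _ => ?_, fun r s hrs hr hs hrz hsz => ?_⟩
  · by_cases hrO : r ∈ O
    · rw [f_of_mem r hrO]
      exact hrow r hrO
    · obtain rfl | hrz := eq_or_ne r z
      · simpa [f, hrO] using IsRow.zero κ r
      · simp only [f, hrO, hrz, if_false]
        exact isRow_update_sum hrz.symm hzκ (by simp [h]) fun s hs => by simp [h, hs]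
  · have hr' : ¬ κ ≤ (r : ℕ) := Nat.not_le.2 hr
    have hs' : ¬ κ ≤ (s : ℕ) := Nat.not_le.2 hs
    by_cases hrO : r ∈ O <;> by_cases hsO : s ∈ O
    · rw [f_of_mem r hrO, f_of_mem s hsO, hpair r hrO s hsO hrs]
    · rw [f_of_mem r hrO, f_of_notMem s hsO hsz r hrz]
      simp [h, hrs, hr', hrO, hΔ s r, add_left_comm, CharTwo.add_self_eq_zero]
    · rw [f_of_mem s hsO, f_of_notMem r hrO hrz s hsz]
      simp [h, hrs.symm, hs', hsO, add_assoc, CharTwo.add_self_eq_zero]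
    · rw [f_of_notMem r hrO hrz s hsz, f_of_notMem s hsO hsz r hrz]
      rcases lt_or_gt_of_ne hrs with hlt | hlt
      · simp [h, hrO, hsO, hrs, hrs.symm, hr', hs', hlt, hlt.not_gt]
      · simp [h, hrO, hsO, hrs, hrs.symm, hr', hs', hlt, hlt.not_gt, hΔ s r]

/-- The value of row `z` is determined by the other rows, and its sum vanishes since the remaining
square matrix is symmetric. -/
theorem exists_update_zero {f : Fin P → Fin P → ZMod 2} {z : Fin P}
    (hf : IsRowSwitch κ 0 {z} f) : ∃ w, IsRowSwitch κ 0 ∅ (Function.update f z w) := by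
  let w : Fin P → ZMod 2 := fun s => if s ≠ z ∧ (s : ℕ) < κ then f s z else 0
  have w_apply : ∀ s ≠ z, (s : ℕ) < κ → w s = f s z := fun s h₁ h₂ => if_pos ⟨h₁, h₂⟩
  have sum_w : ∑ s, w s = 0 := by
    simp only [w]
    rw [← Finset.sum_filter]
    refine (Finset.sum_congr rfl fun s hs => (hf.row s (by simp_all)).apply_eq_sum z).trans ?_
    refine sum_sum_eq_zero_of_add_swap_eq_zero _ (fun s hs => (hf.row s (by simp_all)).1)
      fun s hs s' hs' hne => ?_
    simp only [Finset.mem_filter, Finset.mem_univ, true_and] at hs hs'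
    exact hf.pair s s' hne hs.2 hs'.2 hs.1 hs'.1
  refine ⟨w, fun r hr => ?_, fun r s hrs hr hs _ _ => ?_⟩
  · obtain rfl | hrz := eq_or_ne r z
    · rw [Function.update_self]
      exact ⟨by simp [w], fun s hs => by simp [w, Nat.not_lt.2 hs], sum_w⟩
    · rw [Function.update_of_ne hrz]
      exact hf.row r hr
  · obtain rfl | hrz := eq_or_ne r z
    · simp [hrs.symm, w_apply s hrs.symm hs, CharTwo.add_self_eq_zero]
    · obtain rfl | hsz := eq_or_ne s z
      · simp [hrs, w_apply r hrs hr, CharTwo.add_self_eq_zero]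
      · simpa [hrz, hsz] using hf.pair r s hrs hr hs hrz hsz

theorem exists_update_of_ne {f : Fin P → Fin P → ZMod 2} {z z' : Fin P}
    (hΔ : ∀ r s, Δ r s = Δ s r) (hf : IsRowSwitch κ Δ {z} f) (hz' : (z' : ℕ) < κ) (hne : z' ≠ z) :
    ∃ w, IsRowSwitch κ Δ {z'} (Function.update f z w) := by
  let u : Fin P → ZMod 2 := fun s => if s = z ∨ κ ≤ s then 0 else Δ z s + f s z
  let w : Fin P → ZMod 2 := Function.update u z' (∑ s ∈ Finset.univ.erase z', u s)
  have add_w : ∀ s : Fin P, s ≠ z → s ≠ z' → (s : ℕ) < κ → w s + f s z = Δ z s :=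
    fun s hsz hsz' hs => by
      simp [w, u, hsz, hsz', Nat.not_le.2 hs, add_assoc, CharTwo.add_self_eq_zero]
  refine ⟨w, fun r hr => ?_, fun r s hrs hr hs hrz' hsz' => ?_⟩
  · obtain rfl | hrz := eq_or_ne r z
    · rw [Function.update_self]
      exact isRow_update_sum hne hz' (by simp [u]) fun s hs => by simp [u, hs]
    · rw [Function.update_of_ne hrz]
      exact hf.row r hr
  · obtain rfl | hrz := eq_or_ne r z
    · rw [Function.update_self, Function.update_of_ne hrs.symm, add_w s hrs.symm hsz' hs]
    · obtain rfl | hsz := eq_or_ne s z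
      · rw [Function.update_self, Function.update_of_ne hrs, add_comm, add_w r hrs hrz' hr, hΔ]
      · rw [Function.update_of_ne hrz, Function.update_of_ne hsz]
        exact hf.pair r s hrs hr hs hrz hsz

end IsRowSwitch

end RowSwitch

/-! ### Hiding the twists from the spoiler -/

namespace Skeleton

variable {roles rows : ℕ → ℕ} (S : Skeleton roles rows)

/-- The vectors added to the rows of the gadgets: `f x y t r` is added in row `r` of `(x, y, t)`. -/
abbrev Switching : Type := S.B → S.B → Fin S.bound → Fin S.bound → Fin S.bound → ZMod 2

/-- The set of exceptional rows of a gadget at `y`: the row `z` if the level of `y` is at least `l`,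
and none otherwise. -/
def exceptional (l : ℕ) (y : S.B) (z : Fin S.bound) : Set (Fin S.bound) :=
  {r | l ≤ S.lev y ∧ r = z}

/-- A permutation `π` of the skeleton and switchings `f` of the gadgets that transform the graph
given by `b` into the one given by `b'`, except for edges at the exceptional rows `z`. -/
structure IsSwitching (b b' : S.B → S.B → ℕ → Prop) (l : ℕ) (π : Equiv.Perm S.B) (f : S.Switching)
    (z : S.B → S.B → Fin S.bound → Fin S.bound) : Prop where
  levelwise : IsLevelwise S.lev l π
  gadget : ∀ x y (t : Fin S.bound), S.lev x < S.lev y → IsRowSwitch (rows (S.lev y))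
    (fun r s => twist (b x y t) r s + twist (b' (π x) (π y) t) r s)
    (S.exceptional l y (z x y t)) (f x y t)

/-- The row of `w` is the image of the row of `v` under the permutation `π` of the points. -/
structure SameRow (π : Equiv.Perm S.B) (v w : S.GadgetVertex) : Prop where
  x_eq : w.x = π v.x
  y_eq : w.y = π v.y
  t_eq : w.t = v.t
  r_eq : w.r = v.r

/-- The vertex `w` is the image of the vertex `v` under a permutation and a switching. -/
def Moved (π : Equiv.Perm S.B) (f : S.Switching) : S.Vertex → S.Vertex → Prop
  | .inl β, .inl γ => γ = π β
  | .inr v, .inr w => S.SameRow π v w ∧ w.u = v.u + f v.x v.y v.t v.r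
  | _, _ => False

/-- The vertex does not lie in an exceptional row. -/
def Free (l : ℕ) (z : S.B → S.B → Fin S.bound → Fin S.bound) : S.Vertex → Prop
  | .inl _ => True
  | .inr v => v.r ∉ S.exceptional l v.y (z v.x v.y v.t)

/-- The positions from which the duplicator wins: a switching moves every pebbled vertex to its
partner, and no pebbled vertex lies in an exceptional row. -/
def positions (b b' : S.B → S.B → ℕ → Prop) (l : ℕ) : Set (Set (S.Vertex × S.Vertex)) :=
  {s | ∃ π f z, S.IsSwitching b b' l π f z ∧ ∀ p ∈ s, S.Moved π f p.1 p.2 ∧ S.Free l z p.1}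

variable {S}

section Moved

variable {b b' : S.B → S.B → ℕ → Prop} {l : ℕ} {π : Equiv.Perm S.B} {f : S.Switching}
  {z : S.B → S.B → Fin S.bound → Fin S.bound} {v w v' w' : S.Vertex}

theorem Moved.eq_iff (h : S.Moved π f v w) (h' : S.Moved π f v' w') : v = v' ↔ w = w' := by
  rcases v with β | v <;> rcases w with γ | w <;> try exact h.elim
  all_goals rcases v' with β' | v' <;> rcases w' with γ' | w' <;> try exact h'.elim
  · obtain rfl : γ = π β := h
    obtain rfl : γ' = π β' := h'
    simp
  · simp
  · simp
  · obtain ⟨⟨hx, hy, ht, hr⟩, hu⟩ := h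
    obtain ⟨⟨hx', hy', ht', hr'⟩, hu'⟩ := h'
    simp only [Sum.inr.injEq, GadgetVertex.ext_iff, hx, hy, ht, hr, hu, hx', hy', ht', hr', hu',
      π.injective.eq_iff]
    refine and_congr_right fun ex => and_congr_right fun ey => and_congr_right fun et =>
      and_congr_right fun er => ?_
    rw [ex, ey, et, er, add_left_inj]

theorem exists_equiv_moved (hs : S.IsSwitching b b' l π f z) :
    ∃ σ : S.Vertex ≃ S.Vertex, ∀ v, S.Moved π f v (σ v) := by
  have h : ∀ v, ∃ w, S.Moved π f v w := by
    have hlev := hs.levelwise.lev_eq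
    rintro (β | v)
    · exact ⟨.inl (π β), rfl⟩
    · exact ⟨.inr ⟨π v.x, π v.y, v.t, v.r, v.u + f v.x v.y v.t v.r,
        by rw [hlev, hlev]; exact v.lev_lt, by rw [hlev]; exact v.t_lt, by rw [hlev]; exact v.r_lt,
        by rw [hlev]; exact v.row.add ((hs.gadget _ _ _ v.lev_lt).row _ v.r_lt)⟩,
        ⟨rfl, rfl, rfl, rfl⟩, rfl⟩
  choose σ hσ using h
  have inj : Function.Injective σ := fun v w e => ((hσ v).eq_iff (hσ w)).2 e
  exact ⟨Equiv.ofBijective σ (Finite.injective_iff_bijective.1 inj), hσ⟩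

theorem adj_inr_inr_of_ne {v w : S.GadgetVertex} (hx : v.x = w.x) (hy : v.y = w.y)
    (ht : v.t = w.t) (hr : v.r ≠ w.r) :
    S.Adj b (.inr v) (.inr w) ↔ v.u w.r + w.u v.r = twist (b v.x v.y v.t) v.r w.r := by
  have hvw : v ≠ w := fun h => hr (congrArg _ h)
  simp [Adj, hx, hy, ht, hr, hvw]

theorem Moved.adj_congr_iff {v w v' w' : S.GadgetVertex} (h : S.Moved π f (.inr v) (.inr w))
    (h' : S.Moved π f (.inr v') (.inr w')) (hx : v.x = v'.x) (hy : v.y = v'.y) (ht : v.t = v'.t)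
    (hr : v.r ≠ v'.r) :
    (S.Adj b (.inr v) (.inr v') ↔ S.Adj b' (.inr w) (.inr w')) ↔
      f v.x v.y v.t v.r v'.r + f v.x v.y v.t v'.r v.r =
        twist (b v.x v.y v.t) v.r v'.r + twist (b' (π v.x) (π v.y) v.t) v.r v'.r := by
  have cancel : ∀ A c d e : ZMod 2, (A = c ↔ A + d = e) ↔ d = c + e := by decide
  obtain ⟨⟨hwx, hwy, hwt, hwr⟩, hwu⟩ := h
  obtain ⟨⟨hwx', hwy', hwt', hwr'⟩, hwu'⟩ := h'
  rw [adj_inr_inr_of_ne hx hy ht hr, adj_inr_inr_of_ne (by rw [hwx, hwx', hx])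
    (by rw [hwy, hwy', hy]) (by rw [hwt, hwt', ht]) (by rwa [hwr, hwr']), hwx, hwy, hwt, hwr, hwr',
    hwu, hwu', ← hx, ← hy, ← ht, Pi.add_apply, Pi.add_apply, add_add_add_comm, cancel]

theorem Moved.adj_inr_iff (hs : S.IsSwitching b b' l π f z) {v w v' w' : S.GadgetVertex}
    (h : S.Moved π f (.inr v) (.inr w)) (h' : S.Moved π f (.inr v') (.inr w'))
    (hv : S.Free l z (.inr v)) (hv' : S.Free l z (.inr v')) :
    S.Adj b (.inr v) (.inr v') ↔ S.Adj b' (.inr w) (.inr w') := by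
  by_cases hsame : v.x = v'.x ∧ v.y = v'.y ∧ v.t = v'.t ∧ v.r ≠ v'.r
  · obtain ⟨hx, hy, ht, hr⟩ := hsame
    refine (h.adj_congr_iff h' hx hy ht hr).2 ((hs.gadget v.x v.y v.t v.lev_lt).pair v.r v'.r hr
      v.r_lt (hy ▸ v'.r_lt) hv ?_)
    rw [hx, hy, ht]
    exact hv'
  · have hsame' : ¬ (w.x = w'.x ∧ w.y = w'.y ∧ w.t = w'.t ∧ w.r ≠ w'.r) := by
      rwa [h.1.x_eq, h'.1.x_eq, h.1.y_eq, h'.1.y_eq, h.1.t_eq, h'.1.t_eq, h.1.r_eq, h'.1.r_eq,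
        π.injective.eq_iff, π.injective.eq_iff]
    have heq := h.eq_iff h'
    simp only [Sum.inr.injEq] at heq
    simp only [Adj, heq]
    tauto

theorem Moved.adj_iff (hl : 0 < l) (hs : S.IsSwitching b b' l π f z) (h : S.Moved π f v w)
    (h' : S.Moved π f v' w') (hv : S.Free l z v) (hv' : S.Free l z v') :
    S.Adj b v v' ↔ S.Adj b' w w' := by
  have hlev := hs.levelwise.lev_eq
  have hlab : ∀ β, S.lev β = 0 → π β = β := fun β hβ => hs.levelwise.fix β (hβ ▸ hl)
  rcases v with β | v <;> rcases w with γ | w <;> try exact h.elim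
  all_goals rcases v' with β' | v' <;> rcases w' with γ' | w' <;> try exact h'.elim
  · obtain rfl : γ = π β := h
    obtain rfl : γ' = π β' := h'
    simp only [Adj, hlev, π.injective.eq_iff]
    by_cases h₁ : S.lev β = 0 <;> by_cases h₂ : S.lev β' = 0 <;> simp [h₁, h₂, hlab]
  · obtain rfl : γ = π β := h
    simp only [Adj, h'.1.x_eq, π.injective.eq_iff]
  · obtain rfl : γ' = π β' := h'
    simp only [Adj, h.1.y_eq, h.1.t_eq, h.1.r_eq, π.injective.eq_iff, hlev]
    by_cases h₂ : S.lev β' = 0 <;> simp [h₂, hlab]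
  · exact adj_inr_iff hs h h' hv hv'

end Moved

theorem _root_.IsRowSwitch.exists_exceptional_disjoint {l : ℕ} {y : S.B}
    {Δ f : Fin S.bound → Fin S.bound → ZMod 2} {z : Fin S.bound} (hΔ : ∀ r s, Δ r s = Δ s r)
    (hf : IsRowSwitch (rows (S.lev y)) Δ (S.exceptional l y z) f) {T : Set (Fin S.bound)}
    (hz : z ∈ T) (hT : l ≤ S.lev y → T.ncard < rows (S.lev y)) :
    ∃ f' z', IsRowSwitch (rows (S.lev y)) Δ (S.exceptional l y z') f' ∧
      (∀ r ∉ S.exceptional l y z, f' r = f r) ∧ Disjoint T (S.exceptional l y z') := by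
  by_cases hl : l ≤ S.lev y
  · have hexc : ∀ z, S.exceptional l y z = {z} := fun z => by simp [exceptional, hl]
    obtain ⟨z', hz'κ, hz'T⟩ := exists_row_notMem (S.rows_le _ (S.levels.lev_le y)) (hT hl)
    obtain ⟨w, hw⟩ := IsRowSwitch.exists_update_of_ne hΔ (hexc z ▸ hf) hz'κ
      fun h => hz'T (h ▸ hz)
    refine ⟨Function.update f z w, z', (hexc z').symm ▸ hw, fun r hr => ?_, ?_⟩
    · rw [hexc] at hr
      exact Function.update_of_ne hr _ _
    · rw [hexc]
      exact Set.disjoint_singleton_right.2 hz'T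
  · exact ⟨f, z, hf, fun _ _ => rfl, Set.disjoint_right.2 fun _ hr => absurd hr.1 hl⟩

/-- Only the pebbled rows are visible, hence an exceptional row can be moved away from the vertex
that the spoiler is about to choose. -/
theorem positions_extend {b b' : S.B → S.B → ℕ → Prop} {l k : ℕ}
    (hk : ∀ i, l ≤ i → i ≤ S.height → k < rows i) {s : Set (S.Vertex × S.Vertex)}
    (hs : s ∈ S.positions b b' l) (hcard : s.ncard < k) :
    ∃ σ : S.Vertex ≃ S.Vertex, ∀ v, insert (v, σ v) s ∈ S.positions b b' l := by
  obtain ⟨π, f, z, hsw, hpos⟩ := hs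
  let T : S.B → S.B → Fin S.bound → Set (Fin S.bound) := fun x y t =>
    insert (z x y t) ((fun p => Sum.elim (fun _ => z x y t) GadgetVertex.r p.1) '' s)
  have hT : ∀ x y t, l ≤ S.lev y → (T x y t).ncard < rows (S.lev y) := fun x y t hy =>
    calc (T x y t).ncard ≤ s.ncard + 1 :=
          (Set.ncard_insert_le _ _).trans (Nat.succ_le_succ (Set.ncard_image_le s.toFinite))
      _ ≤ k := hcard
      _ < rows (S.lev y) := hk _ hy (S.levels.lev_le y)
  have hgadget : ∀ x y (t : Fin S.bound), ∃ f' z', S.lev x < S.lev y →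
      IsRowSwitch (rows (S.lev y)) (fun r s => twist (b x y t) r s + twist (b' (π x) (π y) t) r s)
        (S.exceptional l y z') f' ∧ (∀ r ∉ S.exceptional l y (z x y t), f' r = f x y t r) ∧
        Disjoint (T x y t) (S.exceptional l y z') := by
    intro x y t
    by_cases hxy : S.lev x < S.lev y
    · obtain ⟨f', z', h⟩ := (hsw.gadget x y t hxy).exists_exceptional_disjoint
        (fun r s => by rw [twist_comm, twist_comm (b' _ _ _)]) (Set.mem_insert _ _) (hT x y t)
      exact ⟨f', z', fun _ => h⟩
    · exact ⟨f x y t, z x y t, fun h => absurd h hxy⟩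
  choose f' z' hf' using hgadget
  have hsw' : S.IsSwitching b b' l π f' z' :=
    ⟨hsw.levelwise, fun x y t hxy => (hf' x y t hxy).1⟩
  have hmoved : ∀ v v', S.Free l z v → (S.Moved π f' v v' ↔ S.Moved π f v v') := by
    rintro (β | v) (γ | w) hv <;> try exact Iff.rfl
    simp only [Moved, (hf' _ _ _ v.lev_lt).2.1 _ hv]
  obtain ⟨σ, hσ⟩ := exists_equiv_moved hsw'
  refine ⟨σ, fun v => ?_⟩
  by_cases hv : S.Free l z v
  · exact ⟨π, f, z, hsw, Set.forall_mem_insert.2 ⟨⟨(hmoved _ _ hv).1 (hσ v), hv⟩, hpos⟩⟩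
  refine ⟨π, f', z', hsw', Set.forall_mem_insert.2 ⟨⟨hσ v, ?_⟩, fun p hp =>
    ⟨(hmoved _ _ (hpos p hp).2).2 (hpos p hp).1, ?_⟩⟩⟩
  · rcases v with β | v
    · trivial
    · exact Set.disjoint_left.1 (hf' _ _ _ v.lev_lt).2.2 (.inl (not_not.1 hv).2)
  · rcases hpv : p.1 with β | v
    · trivial
    · exact Set.disjoint_left.1 (hf' _ _ _ v.lev_lt).2.2 (.inr ⟨p, hp, by simp [hpv]⟩)

theorem isBijectiveSystem_positions (b b' : S.B → S.B → ℕ → Prop) {l k : ℕ} (hl : 0 < l)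
    (hk : ∀ i, l ≤ i → i ≤ S.height → k < rows i) :
    IsBijectiveSystem (S.graph b) (S.graph b') k (S.positions b b' l) where
  eq_iff := by
    rintro s ⟨π, f, z, -, h⟩ p hp p' hp'
    exact (h p hp).1.eq_iff (h p' hp').1
  adj_iff := by
    rintro s ⟨π, f, z, hsw, h⟩ p hp p' hp'
    exact (h p hp).1.adj_iff hl hsw (h p' hp').1 (h p hp).2 (h p' hp').2
  mono := by
    rintro s ⟨π, f, z, hsw, h⟩ t ht
    exact ⟨π, f, z, hsw, fun p hp => h p (ht hp)⟩
  extend _ hs hcard := positions_extend hk hs hcard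

end Skeleton

/-! ### Tuples with the same information -/

namespace Skeleton

variable {roles rows : ℕ → ℕ} {S : Skeleton roles rows} {b b' : S.B → S.B → ℕ → Prop} {l : ℕ}
  {π : Equiv.Perm S.B} {f : S.Switching}

theorem exists_isRowSwitch_exceptional [Nonempty (Fin S.bound)] {y : S.B}
    {Δ f₀ : Fin S.bound → Fin S.bound → ZMod 2} (hΔ : ∀ r s, Δ r s = Δ s r)
    (hΔl : S.lev y < l → Δ = 0) {O : Set (Fin S.bound)}
    (hO : l ≤ S.lev y → O.ncard < rows (S.lev y)) (hrow : ∀ r ∈ O, IsRow (rows (S.lev y)) r (f₀ r))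
    (hpair : ∀ r ∈ O, ∀ s ∈ O, r ≠ s → f₀ r s + f₀ s r = Δ r s) :
    ∃ f z, IsRowSwitch (rows (S.lev y)) Δ (S.exceptional l y z) f ∧ (∀ r ∈ O, f r = f₀ r) ∧
      Disjoint O (S.exceptional l y z) := by
  have disjoint_of_notMem : ∀ z ∉ O, Disjoint O (S.exceptional l y z) := fun z hz =>
    Set.disjoint_left.2 fun r hr h => hz (h.2 ▸ hr)
  by_cases hz : ∃ z : Fin S.bound, (z : ℕ) < rows (S.lev y) ∧ z ∉ O
  · obtain ⟨z, hzκ, hz⟩ := hz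
    obtain ⟨f, hfO, hf⟩ := IsRowSwitch.exists_extend hΔ hrow hpair hz hzκ
    rcases Nat.lt_or_ge (S.lev y) l with hl | hl
    · obtain ⟨w, hw⟩ := (hΔl hl ▸ hf).exists_update_zero
      have hexc : S.exceptional l y z = ∅ := by simp [exceptional, Nat.not_le.2 hl]
      refine ⟨Function.update f z w, z, hΔl hl ▸ hexc ▸ hw, fun r hr => ?_, disjoint_of_notMem z hz⟩
      rw [Function.update_of_ne (ne_of_mem_of_not_mem hr hz), hfO r hr]
    · have hexc : S.exceptional l y z = {z} := by simp [exceptional, hl]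
      exact ⟨f, z, hexc ▸ hf, hfO, disjoint_of_notMem z hz⟩
  · push Not at hz
    have hl : S.lev y < l := by
      by_contra! hl
      obtain ⟨z, hzκ, hzO⟩ := exists_row_notMem (S.rows_le _ (S.levels.lev_le y)) (hO hl)
      exact hzO (hz z hzκ)
    exact ⟨f₀, Classical.arbitrary _, ⟨fun r hr => hrow r (hz r hr), fun r s hrs hr hs _ _ =>
      hpair r (hz r hr) s (hz s hs) hrs⟩, fun _ _ => rfl,
      Set.disjoint_right.2 fun _ h => absurd h.1 (Nat.not_le.2 hl)⟩

theorem testBit_diff_inr {v w : S.GadgetVertex} (h : S.SameRow 1 v w) {s : Fin S.bound}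
    (hs : s ≠ v.r) (hsκ : (s : ℕ) < rows (S.lev v.y)) :
    (S.diff b (.inr v) (.inr w)).testBit (Nat.pair v.t s) = true ↔ v.u s ≠ w.u s := by
  obtain ⟨hx : w.x = v.x, hy : w.y = v.y, ht, hr⟩ := h
  have cancel : ∀ c d e f : ZMod 2, ¬ (c + d = e ↔ c + f = e) ↔ d ≠ f := by decide
  have adj_iff : ∀ z : S.GadgetVertex, z.x = v.x → z.y = v.y → z.t = v.t → z.r = s →
      (¬ (S.Adj b (.inr z) (.inr v) ↔ S.Adj b (.inr z) (.inr w)) ↔ v.u s ≠ w.u s) := by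
    rintro z hzx hzy hzt rfl
    rw [adj_inr_inr_of_ne hzx hzy hzt hs, adj_inr_inr_of_ne (hzx.trans hx.symm)
      (hzy.trans hy.symm) (hzt.trans ht.symm) (hr ▸ hs), hr, cancel]
  rw [testBit_diff]
  constructor
  · rintro ⟨z, hz, hadj⟩
    obtain ⟨hzt, hzr⟩ := Nat.pair_eq_pair.1 hz
    by_cases hxy : z.x = v.x ∧ z.y = v.y
    · exact (adj_iff z hxy.1 hxy.2 (Fin.ext hzt) (Fin.ext hzr)).1 hadj
    · have not_adj : ∀ v' : S.GadgetVertex, v'.x = v.x → v'.y = v.y → v'.r = v.r →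
          ¬ S.Adj b (.inr z) (.inr v') := by
        rintro v' hx' hy' hr' (rfl | h)
        exacts [hs (Fin.ext hzr ▸ hr'), hxy ⟨h.1.trans hx', h.2.1.trans hy'⟩]
      exact absurd (iff_of_false (not_adj v rfl rfl rfl) (not_adj w hx hy hr)) hadj
  · intro hne
    let z : S.GadgetVertex := ⟨v.x, v.y, v.t, s, 0, v.lev_lt, v.t_lt, hsκ, IsRow.zero _ _⟩
    exact ⟨z, rfl, (adj_iff z rfl rfl rfl rfl).2 hne⟩

theorem add_eq_add_of_diff_eq (hπ : IsLevelwise S.lev l π) {v w v' w' : S.GadgetVertex}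
    (h : S.SameRow 1 v w) (hv : S.SameRow π v v') (hw : S.SameRow π w w')
    (hdiff : S.diff b (.inr v) (.inr w) = S.diff b' (.inr v') (.inr w')) :
    v.u + v'.u = w.u + w'.u := by
  obtain ⟨hx : w.x = v.x, hy : w.y = v.y, ht, hr⟩ := h
  have h' : S.SameRow 1 v' w' := ⟨by rw [hw.x_eq, hx, hv.x_eq]; rfl,
    by rw [hw.y_eq, hy, hv.y_eq]; rfl, by rw [hw.t_eq, ht, hv.t_eq], by rw [hw.r_eq, hr, hv.r_eq]⟩
  have row_w := hr ▸ hy ▸ w.row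
  have row_v' : IsRow (rows (S.lev v.y)) v.r v'.u := by
    simpa only [hv.y_eq, hπ.lev_eq, hv.r_eq] using v'.row
  have row_w' : IsRow (rows (S.lev v.y)) v.r w'.u := by
    simpa only [hw.y_eq, hπ.lev_eq, hw.r_eq, hr, hy] using w'.row
  funext s
  simp only [Pi.add_apply]
  by_cases hs : s = v.r
  · subst hs
    rw [v.row.1, row_w.1, row_v'.1, row_w'.1]
  by_cases hκ : (s : ℕ) < rows (S.lev v.y)
  · have hbit := testBit_diff_inr (b := b) ⟨hx, hy, ht, hr⟩ hs hκ
    have hbit' := testBit_diff_inr (b := b') h' (hv.r_eq ▸ hs)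
      (by rwa [hv.y_eq, hπ.lev_eq])
    rw [hdiff, ← hv.t_eq, hbit'] at hbit
    have cancel : ∀ A B C D : ZMod 2, (C ≠ D ↔ A ≠ B) → A + C = B + D := by decide
    exact cancel _ _ _ _ hbit
  · have hκ := Nat.not_lt.1 hκ
    rw [v.row.2.1 s hκ, row_w.2.1 s hκ, row_v'.2.1 s hκ, row_w'.2.1 s hκ]

theorem Moved.isRow (hπ : IsLevelwise S.lev l π) {v w : S.GadgetVertex}
    (h : S.Moved π f (.inr v) (.inr w)) :
    IsRow (rows (S.lev v.y)) v.r (f v.x v.y v.t v.r) := by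
  have hw : IsRow (rows (S.lev v.y)) v.r w.u := by
    simpa only [h.1.y_eq, hπ.lev_eq, h.1.r_eq] using w.row
  have hf : f v.x v.y v.t v.r = v.u + w.u := by
    rw [h.2, ← add_assoc, ZModModule.add_self, zero_add]
  exact hf ▸ v.row.add hw

section SameInfo

variable {m : ℕ} {a a' : Fin m → S.Vertex}

theorem coord_zero_eq_coord_one_iff (v : S.Vertex) :
    S.coord v 0 = S.coord v 1 ↔ ∃ β, v = .inl β := by
  rcases v with β | v
  · simp [coord]
  · have hne : v.x ≠ v.y := fun h => absurd (congrArg S.lev h) v.lev_lt.ne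
    simpa [coord] using hne

/-- The rows of the gadget `(x, y, t)` that contain an entry of the tuple. -/
def occupied (a : Fin m → S.Vertex) (x y : S.B) (t : Fin S.bound) : Set (Fin S.bound) :=
  {r | ∃ i v, a i = .inr v ∧ v.x = x ∧ v.y = y ∧ v.t = t ∧ v.r = r}

theorem ncard_occupied_le (a : Fin m → S.Vertex) (x y : S.B) (t : Fin S.bound) :
    (occupied a x y t).ncard ≤ m := by
  have hsub : occupied a x y t ⊆
      (fun i => Sum.elim (fun _ => t) GadgetVertex.r (a i)) '' Set.univ := by
    rintro r ⟨i, v, hi, -, -, -, rfl⟩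
    exact ⟨i, trivial, by simp [hi]⟩
  simpa using (Set.ncard_le_ncard hsub).trans (Set.ncard_image_le Set.finite_univ)

theorem SameInfo.exists_perm (h : S.SameInfo b b' l a a') :
    ∃ π, IsLevelwise S.lev l π ∧ ∀ i c, π (S.coord (a i) c) = S.coord (a' i) c := by
  obtain ⟨π, hπ, hcoord⟩ := IsLevelwise.exists_extend
    (p := fun i : Fin m × Fin 3 => S.coord (a i.1) i.2) (p' := fun i => S.coord (a' i.1) i.2)
    (fun i => h.lev_eq i.1 i.2) (fun i => h.low_eq i.1 i.2) fun i j => h.eq_iff i.1 i.2 j.1 j.2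
  exact ⟨π, hπ, fun i c => hcoord (i, c)⟩

theorem SameInfo.exists_inl (h : S.SameInfo b b' l a a') {i : Fin m} {β : S.B}
    (hi : a i = .inl β) : ∃ γ, a' i = .inl γ := by
  rw [← coord_zero_eq_coord_one_iff, ← h.eq_iff i 0 i 1, hi]
  rfl

theorem SameInfo.exists_inr (h : S.SameInfo b b' l a a') {i : Fin m} {v : S.GadgetVertex}
    (hi : a i = .inr v) : ∃ w, a' i = .inr w := by
  rcases hi' : a' i with γ | w
  · have hv := (coord_zero_eq_coord_one_iff (a i)).1 ((h.eq_iff i 0 i 1).2 (by rw [hi']; rfl))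
    simp [hi] at hv
  · exact ⟨w, rfl⟩

theorem SameInfo.sameRow (h : S.SameInfo b b' l a a') (hl : 0 < l)
    (hπ : ∀ i c, π (S.coord (a i) c) = S.coord (a' i) c) {i : Fin m} {v w : S.GadgetVertex}
    (hi : a i = .inr v) (hi' : a' i = .inr w) : S.SameRow π v w := by
  have hx := hπ i 0
  have hy := hπ i 1
  have hlab := h.low_eq i 2
  simp only [hi, hi', coord] at hx hy hlab
  obtain ⟨ht, hr⟩ := Nat.pair_eq_pair.1 (S.lab_inj (v.pair_lt.trans S.bits_lt_two_pow)
    (w.pair_lt.trans S.bits_lt_two_pow) (hlab ((S.levels.lev_lab _).trans_lt hl)))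
  exact ⟨hx.symm, hy.symm, (Fin.ext ht).symm, (Fin.ext hr).symm⟩

theorem SameInfo.exists_moved (h : S.SameInfo b b' l a a') (hl : 0 < l)
    (hπ : IsLevelwise S.lev l π) (hcoord : ∀ i c, π (S.coord (a i) c) = S.coord (a' i) c) :
    ∃ f : S.Switching, ∀ i, S.Moved π f (a i) (a' i) := by
  have hf : ∀ x y (t r : Fin S.bound), ∃ g : Fin S.bound → ZMod 2, ∀ i v w, a i = .inr v →
      a' i = .inr w → v.x = x → v.y = y → v.t = t → v.r = r → w.u = v.u + g := by
    intro x y t r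
    by_cases hr : r ∈ occupied a x y t
    · obtain ⟨i, v, hi, rfl, rfl, rfl, rfl⟩ := hr
      obtain ⟨w, hi'⟩ := h.exists_inr hi
      refine ⟨v.u + w.u, fun j v' w' hj hj' hx hy ht hr => ?_⟩
      have hdiff := h.diff_eq i j
      rw [hi, hi', hj, hj'] at hdiff
      rw [add_eq_add_of_diff_eq hπ ⟨hx, hy, ht, hr⟩ (h.sameRow hl hcoord hi hi')
        (h.sameRow hl hcoord hj hj') hdiff, ← add_assoc, ZModModule.add_self, zero_add]
    · exact ⟨0, fun i v w hi _ hx hy ht hr' => absurd ⟨i, v, hi, hx, hy, ht, hr'⟩ hr⟩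
  choose f hf using hf
  refine ⟨f, fun i => ?_⟩
  rcases hi : a i with β | v
  · obtain ⟨γ, hi'⟩ := h.exists_inl hi
    have hγ := hcoord i 0
    rw [hi, hi'] at hγ
    rw [hi']
    exact hγ.symm
  · obtain ⟨w, hi'⟩ := h.exists_inr hi
    rw [hi']
    exact ⟨h.sameRow hl hcoord hi hi', hf _ _ _ _ i v w hi hi' rfl rfl rfl rfl⟩

theorem SameInfo.add_eq_of_mem_occupied (h : S.SameInfo b b' l a a')
    (hf : ∀ i, S.Moved π f (a i) (a' i)) {x y : S.B} {t r s : Fin S.bound}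
    (hr : r ∈ occupied a x y t) (hs : s ∈ occupied a x y t) (hne : r ≠ s) :
    f x y t r s + f x y t s r = twist (b x y t) r s + twist (b' (π x) (π y) t) r s := by
  obtain ⟨i, v, hi, rfl, rfl, rfl, rfl⟩ := hr
  obtain ⟨j, w, hj, hx, hy, ht, rfl⟩ := hs
  obtain ⟨v', hi'⟩ := h.exists_inr hi
  obtain ⟨w', hj'⟩ := h.exists_inr hj
  exact ((hi' ▸ hi ▸ hf i).adj_congr_iff (hj' ▸ hj ▸ hf j) hx.symm hy.symm ht.symm hne).1
    (hi' ▸ hi ▸ hj' ▸ hj ▸ h.adj_iff i j)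

theorem SameInfo.mem_positions (h : S.SameInfo b b' l a a') (hl : 0 < l)
    (hb : ∀ x y t, S.lev y < l → (b x y t ↔ b' x y t))
    (hm : ∀ i, l ≤ i → i ≤ S.height → m < rows i) : tuplePairs a a' ∈ S.positions b b' l := by
  obtain ⟨π, hπ, hcoord⟩ := h.exists_perm
  obtain ⟨f₀, hf₀⟩ := h.exists_moved hl hπ hcoord
  have hgadget : ∀ x y (t : Fin S.bound), ∃ f z, S.lev x < S.lev y → IsRowSwitch (rows (S.lev y))
      (fun r s => twist (b x y t) r s + twist (b' (π x) (π y) t) r s) (S.exceptional l y z) f ∧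
      (∀ r ∈ occupied a x y t, f r = f₀ x y t r) ∧
      Disjoint (occupied a x y t) (S.exceptional l y z) := by
    intro x y t
    have : Nonempty (Fin S.bound) := ⟨t⟩
    by_cases hxy : S.lev x < S.lev y
    · obtain ⟨f, z, hfz⟩ := exists_isRowSwitch_exceptional (S := S) (l := l) (f₀ := f₀ x y t)
        (Δ := fun r s => twist (b x y t) r s + twist (b' (π x) (π y) t) r s)
        (fun r s => by rw [twist_comm, twist_comm (b' _ _ _)])
        (fun hy => by
          funext r s
          rw [hπ.fix y hy, hπ.fix x (hxy.trans hy), propext (hb x y t hy)]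
          exact CharTwo.add_self_eq_zero _)
        (fun hy => (ncard_occupied_le a x y t).trans_lt (hm _ hy (S.levels.lev_le y)))
        (by
          rintro r ⟨i, v, hi, rfl, rfl, rfl, rfl⟩
          obtain ⟨w, hi'⟩ := h.exists_inr hi
          exact (hi' ▸ hi ▸ hf₀ i : S.Moved π f₀ (.inr v) (.inr w)).isRow hπ)
        (fun r hr s hs => h.add_eq_of_mem_occupied hf₀ hr hs)
      exact ⟨f, z, fun _ => hfz⟩
    · exact ⟨0, t, fun h => absurd h hxy⟩
  choose f z hfz using hgadget
  refine ⟨π, f, z, ⟨hπ, fun x y t hxy => (hfz x y t hxy).1⟩, ?_⟩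
  rintro _ ⟨i, rfl⟩
  have hmoved := hf₀ i
  dsimp only
  rcases hi : a i with β | v <;> rcases hi' : a' i with γ | w <;> rw [hi, hi'] at hmoved
  · exact ⟨hmoved, trivial⟩
  · exact hmoved.elim
  · exact hmoved.elim
  · have hocc : v.r ∈ occupied a v.x v.y v.t := ⟨i, v, hi, rfl, rfl, rfl, rfl⟩
    obtain ⟨-, heq, hdisj⟩ := hfz v.x v.y v.t v.lev_lt
    exact ⟨⟨hmoved.1, (heq _ hocc).symm ▸ hmoved.2⟩, Set.disjoint_left.1 hdisj hocc⟩

end SameInfo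

theorem rel_iff_of_info_eq (q : PebbleQuery) (hl : 0 < l)
    (hq : ∀ i, l ≤ i → i ≤ S.height → q.arity < rows i ∧ q.width < rows i)
    (hb : ∀ x y t, S.lev y < l → (b x y t ↔ b' x y t)) {a a' : Fin q.arity → S.Vertex}
    (h : S.info b l a = S.info b' l a') : q.rel (S.graph b) a ↔ q.rel (S.graph b') a' :=
  q.invariant (S.graph b) (S.graph b') _
    (isBijectiveSystem_positions b b' hl fun i h₁ h₂ => (hq i h₁ h₂).2) a a'
    ((S.sameInfo_of_info_eq h).mem_positions hl hb fun i h₁ h₂ => (hq i h₁ h₂).1)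

end Skeleton

/-! ### First-order properties of the graphs -/

section RowSwitch

variable {P κ : ℕ} {f : Fin P → Fin P → ZMod 2}

theorem IsRow.sum_filter_lt {r : Fin P} {u : Fin P → ZMod 2} (hu : IsRow κ r u) :
    ∑ s with Fin.val s < κ, u s = 0 := by
  rw [← hu.2.2]
  exact Finset.sum_subset (Finset.subset_univ _) fun s _ hs => hu.2.1 s (by simpa using hs)

/-- The sum of all entries of `f` vanishes, both computed by rows and by pairs of entries, while
the upper half of the twist contains a single entry `1`. -/
theorem not_isRowSwitch_twist_empty (hκ : 2 ≤ κ) (hP : κ ≤ P) :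
    ¬ IsRowSwitch κ (twist True) ∅ f := by
  intro hf
  obtain ⟨r₀, hr₀⟩ : ∃ r₀ : Fin P, (r₀ : ℕ) = 0 := ⟨⟨0, by omega⟩, rfl⟩
  obtain ⟨r₁, hr₁⟩ : ∃ r₁ : Fin P, (r₁ : ℕ) = 1 := ⟨⟨1, by omega⟩, rfl⟩
  let upper : Fin P → Fin P → ZMod 2 := fun r s => if r = r₀ then if s = r₁ then 1 else 0 else 0
  have twist_eq : ∀ r s : Fin P, twist True r s = upper r s + upper s r := by
    intro r s
    simp only [twist, upper, Fin.ext_iff, hr₀, hr₁, true_and]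
    split_ifs <;> first | omega | simp
  have hsum : ∑ r with Fin.val r < κ, ∑ s with Fin.val s < κ,
      (f r s + upper r s) = 0 := by
    refine sum_sum_eq_zero_of_add_swap_eq_zero _ (fun r hr => ?_) fun r hr s hs hrs => ?_
    · rw [(hf.row r (by simpa using hr)).1, zero_add]
      simp only [upper, Fin.ext_iff, hr₀, hr₁]
      split_ifs <;> first | omega | rfl
    · rw [add_add_add_comm, ← twist_eq, hf.pair r s hrs (by simpa using hr) (by simpa using hs)
        (Set.notMem_empty r) (Set.notMem_empty s), CharTwo.add_self_eq_zero]
  have hrows : ∑ r with Fin.val r < κ, ∑ s with Fin.val s < κ, f r s = 0 :=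
    Finset.sum_eq_zero fun r hr => (hf.row r (by simpa using hr)).sum_filter_lt
  have hupper : ∑ r with Fin.val r < κ, ∑ s with Fin.val s < κ, upper r s = 1 := by
    rw [Finset.sum_eq_single_of_mem r₀ (by simp; omega) (by simp +contextual [upper]),
      Finset.sum_eq_single_of_mem r₁ (by simp; omega) (by simp +contextual [upper])]
    simp [upper]
  simp only [Finset.sum_add_distrib, hrows, hupper, zero_add] at hsum
  exact one_ne_zero hsum

end RowSwitch

namespace Skeleton

variable {roles rows : ℕ → ℕ} (S : Skeleton roles rows)

/-- The vertex is a label. -/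
def IsLabel (v : S.Vertex) : Prop := ∃ β, v = .inl β ∧ S.lev β = 0

/-- The vertex is a point of positive level. -/
def IsPoint (v : S.Vertex) : Prop := ∃ β, v = .inl β ∧ S.lev β ≠ 0

/-- The vertex belongs to a gadget. -/
def IsGadget (v : S.Vertex) : Prop := ∃ g, v = .inr g

/-- The vertex `w` is the label of the level of the point `v`. -/
def IsLevelOf (v w : S.Vertex) : Prop := ∃ β, v = .inl β ∧ w = .inl (S.lab (S.lev β))

/-- The vertex `v` lies in row `r` of the gadget `(x, y, t)`. -/
def IsInRow (v x y : S.Vertex) (t r : ℕ) : Prop :=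
  ∃ g, v = .inr g ∧ x = .inl g.x ∧ y = .inl g.y ∧ (g.t : ℕ) = t ∧ (g.r : ℕ) = r

variable {S}

@[simp] theorem isLabel_inl {β : S.B} : S.IsLabel (.inl β) ↔ S.lev β = 0 := by
  simp [IsLabel]

@[simp] theorem not_isLabel_inr {g : S.GadgetVertex} : ¬ S.IsLabel (.inr g) := by
  simp [IsLabel]

@[simp] theorem isPoint_inl {β : S.B} : S.IsPoint (.inl β) ↔ S.lev β ≠ 0 := by
  simp [IsPoint]

@[simp] theorem not_isPoint_inr {g : S.GadgetVertex} : ¬ S.IsPoint (.inr g) := by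
  simp [IsPoint]

@[simp] theorem not_isGadget_inl {β : S.B} : ¬ S.IsGadget (.inl β) := by
  simp [IsGadget]

@[simp] theorem isGadget_inr {g : S.GadgetVertex} : S.IsGadget (.inr g) := by
  simp [IsGadget]

theorem isLabel_lab (s : ℕ) : S.IsLabel (.inl (S.lab s)) :=
  isLabel_inl.2 (S.levels.lev_lab s)

theorem adj_label_label (b : S.B → S.B → ℕ → Prop) {β γ : S.B} (hβ : S.lev β = 0)
    (hγ : S.lev γ = 0) :
    S.Adj b (.inl β) (.inl γ) ↔ (S.num γ).testBit (S.num β) = true := by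
  simp [Adj, hβ, hγ]

theorem adj_self_iff (b : S.B → S.B → ℕ → Prop) (v : S.Vertex) :
    S.Adj b v v ↔ ¬ S.IsLabel v := by
  rcases v with β | g
  · by_cases hβ : S.lev β = 0
    · rw [adj_label_label b hβ hβ, Nat.testBit_lt_two_pow Nat.lt_two_pow_self]
      simp [hβ]
    · simp [Adj, hβ]
  · simp [Adj]

theorem GadgetVertex.lev_y_ne_zero {g : S.GadgetVertex} : S.lev g.y ≠ 0 :=
  Nat.ne_zero_of_lt g.lev_lt

theorem adj_gadget_label (b : S.B → S.B → ℕ → Prop) {g : S.GadgetVertex} {β : S.B}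
    (hβ : S.lev β = 0) :
    S.Adj b (.inr g) (.inl β) ↔ S.num β = Nat.pair g.t g.r := by
  simp only [Adj, hβ, true_and]
  refine or_iff_right ?_
  rintro rfl
  exact g.lev_y_ne_zero hβ

theorem adj_gadget_point (b : S.B → S.B → ℕ → Prop) {g : S.GadgetVertex} {β : S.B}
    (hβ : S.lev β ≠ 0) : S.Adj b (.inr g) (.inl β) ↔ β = g.y := by
  simp [Adj, hβ]

theorem adj_gadget_lab (b : S.B → S.B → ℕ → Prop) (g : S.GadgetVertex) :
    S.Adj b (.inr g) (.inl (S.lab (Nat.pair g.t g.r))) :=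
  (adj_gadget_label b (S.levels.lev_lab _)).2 (S.num_lab g.pair_lt)

theorem isPoint_iff (b : S.B → S.B → ℕ → Prop) (v : S.Vertex) :
    S.IsPoint v ↔ S.Adj b v v ∧ ∀ w, S.Adj b v w → S.Adj b w w := by
  simp only [adj_self_iff]
  rcases v with β | g
  · simp only [isPoint_inl, isLabel_inl]
    refine ⟨fun hβ => ⟨hβ, ?_⟩, And.left⟩
    rintro (γ | g) hadj
    · simp only [Adj, hβ, false_and, false_or, not_false_eq_true, true_and, ne_eq] at hadj
      rwa [← hadj, isLabel_inl]
    · exact not_isLabel_inr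
  · exact iff_of_false not_isPoint_inr fun h => h.2 _ (adj_gadget_lab b g) (isLabel_lab _)

theorem isGadget_iff (b : S.B → S.B → ℕ → Prop) (v : S.Vertex) :
    S.IsGadget v ↔ S.Adj b v v ∧ ¬ S.IsPoint v := by
  rw [adj_self_iff]
  rcases v with β | g <;> simp

theorem eq_lab_iff {β : S.B} (hβ : S.lev β = 0) {s : ℕ} (hs : s < 2 ^ S.bits) :
    β = S.lab s ↔ S.num β = s := by
  constructor
  · rintro rfl
    exact S.levels.num_lab s hs
  · rintro rfl
    exact (S.levels.lab_num β hβ).symm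

theorem eq_coord_zero_iff (b : S.B → S.B → ℕ → Prop) (v w : S.Vertex) :
    w = .inl (S.coord v 0) ↔ (¬ S.IsGadget v ∧ w = v) ∨
      (S.IsGadget v ∧ ¬ S.IsGadget w ∧ S.Adj b w v) := by
  rcases v with β | g
  · simp [coord]
  · rcases w with γ | g' <;> simp [coord, Adj]

theorem eq_coord_one_iff (b : S.B → S.B → ℕ → Prop) (v w : S.Vertex) :
    w = .inl (S.coord v 1) ↔ (¬ S.IsGadget v ∧ w = v) ∨
      (S.IsGadget v ∧ S.IsPoint w ∧ S.Adj b v w) := by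
  rcases v with β | g
  · simp [coord]
  · rcases w with γ | g'
    · simp only [coord, Matrix.cons_val_one, Matrix.cons_val_zero, Sum.inl.injEq, isGadget_inr,
        not_true_eq_false, false_and, isPoint_inl, true_and, false_or]
      constructor
      · rintro rfl
        exact ⟨g.lev_y_ne_zero, (adj_gadget_point b g.lev_y_ne_zero).2 rfl⟩
      · exact fun ⟨h, h'⟩ => (adj_gadget_point b h).1 h'
    · simp

theorem eq_coord_two_iff (b : S.B → S.B → ℕ → Prop) (v w : S.Vertex) :
    w = .inl (S.coord v 2) ↔ (¬ S.IsGadget v ∧ w = v) ∨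
      (S.IsGadget v ∧ S.IsLabel w ∧ S.Adj b v w) := by
  rcases v with β | g
  · simp [coord]
  · rcases w with γ | g'
    · simp only [coord, Matrix.cons_val, Sum.inl.injEq, isGadget_inr,
        not_true_eq_false, false_and, isLabel_inl, true_and, false_or]
      constructor
      · rintro rfl
        exact ⟨S.levels.lev_lab _, adj_gadget_lab b g⟩
      · rintro ⟨h, h'⟩
        rw [adj_gadget_label b h] at h'
        exact (eq_lab_iff h (g.pair_lt.trans S.bits_lt_two_pow)).2 h'
    · simp

theorem isLevelOf_iff (b : S.B → S.B → ℕ → Prop) (v w : S.Vertex) :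
    S.IsLevelOf v w ↔ (S.IsLabel v ∧ w = .inl (S.lab 0)) ∨
      (S.IsPoint v ∧ S.IsLabel w ∧ S.Adj b w v) := by
  rcases v with β | g
  · simp only [IsLevelOf, Sum.inl.injEq, exists_eq_left', isLabel_inl, isPoint_inl]
    by_cases hβ : S.lev β = 0
    · simp [hβ]
    · rcases w with γ | g'
      · simp only [hβ, false_and, ne_eq, not_false_eq_true, true_and, false_or, isLabel_inl,
          Sum.inl.injEq]
        constructor
        · rintro rfl
          refine ⟨S.levels.lev_lab _, .inr (.inl ⟨S.levels.lev_lab _, hβ, ?_⟩)⟩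
          exact S.levels.num_lab _ (S.lev_lt_two_pow β)
        · rintro ⟨h, h'⟩
          simp only [Adj, h, hβ, false_and, and_false, true_and, not_true_eq_false, false_or,
            or_false, not_false_eq_true, ne_eq] at h'
          exact (eq_lab_iff h (S.lev_lt_two_pow β)).2 h'
      · simp [hβ]
  · simp [IsLevelOf]

theorem lt_of_testBit {d s : ℕ} (hd : d < 2 ^ S.bits) (hs : d.testBit s = true) :
    s < 2 ^ S.bits :=
  (Nat.lt_two_pow_self.trans_le (Nat.ge_two_pow_of_testBit hs)).trans hd

theorem exists_testBit_eq_lab_iff {d : ℕ} (hd : d < 2 ^ S.bits) {γ : S.B} (hγ : S.lev γ = 0) :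
    (∃ s, d.testBit s = true ∧ γ = S.lab s) ↔ d.testBit (S.num γ) = true := by
  constructor
  · rintro ⟨s, hs, hγs⟩
    rwa [(eq_lab_iff hγ (lt_of_testBit hd hs)).1 hγs]
  · exact fun h => ⟨_, h, (S.levels.lab_num γ hγ).symm⟩

theorem eq_lab_iff_adj (b : S.B → S.B → ℕ → Prop) {d : ℕ} (hd : d < 2 ^ S.bits) (w : S.Vertex) :
    w = .inl (S.lab d) ↔ S.IsLabel w ∧ ∀ v, S.IsLabel v →
      (S.Adj b v w ↔ ∃ s, d.testBit s = true ∧ v = .inl (S.lab s)) := by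
  constructor
  · rintro rfl
    refine ⟨isLabel_lab d, ?_⟩
    rintro _ ⟨γ, rfl, hγ⟩
    have hnum : S.num (S.lab d) = d := S.levels.num_lab d hd
    simp only [adj_label_label b hγ (S.levels.lev_lab d), hnum, Sum.inl.injEq,
      exists_testBit_eq_lab_iff hd hγ]
  · rintro ⟨⟨β, rfl, hβ⟩, h⟩
    refine congrArg _ ((eq_lab_iff hβ hd).2 (Nat.eq_of_testBit_eq fun s => Bool.eq_iff_iff.2 ?_))
    by_cases hs : s < 2 ^ S.bits
    · have hnum : S.num (S.lab s) = s := S.levels.num_lab s hs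
      simpa only [adj_label_label b (S.levels.lev_lab s) hβ, Sum.inl.injEq, hnum,
        exists_testBit_eq_lab_iff hd (S.levels.lev_lab s)] using h _ (isLabel_lab s)
    · exact iff_of_false (mt (lt_of_testBit (S.levels.num_lt β hβ)) hs) (mt (lt_of_testBit hd) hs)

theorem eq_lab_diff_iff (b : S.B → S.B → ℕ → Prop) (u v w : S.Vertex) :
    w = .inl (S.lab (S.diff b u v)) ↔ S.IsLabel w ∧ ∀ s, S.IsLabel s →
      (S.Adj b s w ↔ ∃ z, S.IsGadget z ∧ S.Adj b z s ∧ ¬ (S.Adj b z u ↔ S.Adj b z v)) := by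
  rw [eq_lab_iff_adj b (S.diff_lt b u v)]
  refine and_congr_right fun _ => forall_congr' fun s => forall_congr' fun hs => ?_
  obtain ⟨γ, rfl, hγ⟩ := hs
  refine iff_congr Iff.rfl ?_
  have hlab : ∀ z : S.GadgetVertex, γ = S.lab (Nat.pair z.t z.r) ↔ S.Adj b (.inr z) (.inl γ) :=
    fun z => by rw [adj_gadget_label b hγ, eq_lab_iff hγ (z.pair_lt.trans S.bits_lt_two_pow)]
  simp only [testBit_diff, Sum.inl.injEq]
  constructor
  · rintro ⟨_, ⟨z, rfl, hz⟩, hγz⟩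
    exact ⟨.inr z, isGadget_inr, (hlab z).1 hγz, hz⟩
  · rintro ⟨_, ⟨z, rfl⟩, hzγ, hz⟩
    exact ⟨_, ⟨z, rfl, hz⟩, (hlab z).2 hzγ⟩

theorem isInRow_iff (v x y : S.Vertex) {t r : ℕ} (h : Nat.pair t r < 2 ^ S.bits) :
    S.IsInRow v x y t r ↔ S.IsGadget v ∧ x = .inl (S.coord v 0) ∧ y = .inl (S.coord v 1) ∧
      S.coord v 2 = S.lab (Nat.pair t r) := by
  rcases v with β | g
  · simp [IsInRow]
  · have hlab : S.lab (Nat.pair g.t g.r) = S.lab (Nat.pair t r) ↔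
        (g.t : ℕ) = t ∧ (g.r : ℕ) = r := by
      rw [← Nat.pair_eq_pair]
      exact ⟨S.lab_inj (g.pair_lt.trans S.bits_lt_two_pow) h, congrArg S.lab⟩
    simp [IsInRow, coord, hlab]

/-- A clique with one vertex in every row is a row switching without defective row, for the matrix
by which the gadget is twisted. -/
theorem not_twisted_iff (b : S.B → S.B → ℕ → Prop) {β γ : S.B} {l t : ℕ} (hβ : S.lev β < l)
    (hγ : S.lev γ = l) (ht : t < roles l) (hrows : 2 ≤ rows l) :
    ¬ b β γ t ↔ ∃ z : Fin (rows l) → S.Vertex, (∀ r, S.IsInRow (z r) (.inl β) (.inl γ) t r) ∧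
      ∀ r s, r ≠ s → S.Adj b (z r) (z s) := by
  subst hγ
  have hP := S.rows_le _ (S.levels.lev_le γ)
  constructor
  · intro hb
    have htP : t < S.bound := ht.trans_le (S.roles_le _ (S.levels.lev_le γ))
    let g : Fin (rows (S.lev γ)) → S.GadgetVertex := fun r =>
      ⟨β, γ, ⟨t, htP⟩, r.castLE hP, 0, hβ, ht, r.2, IsRow.zero _ _⟩
    refine ⟨fun r => .inr (g r), fun r => ⟨g r, rfl, rfl, rfl, rfl, rfl⟩, fun r s hrs => ?_⟩
    have hr : (g r).r ≠ (g s).r := (Fin.castLE_injective hP).ne hrs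
    refine (adj_inr_inr_of_ne (v := g r) (w := g s) rfl rfl rfl hr).2 ?_
    simp [g, twist, hb]
  · rintro ⟨z, hz, hadj⟩ hb
    choose g hg hx hy ht hr using hz
    let f : Fin S.bound → Fin S.bound → ZMod 2 := fun r =>
      if h : (r : ℕ) < rows (S.lev γ) then (g ⟨r, h⟩).u else 0
    have f_eq : ∀ r, f ((g r).r) = (g r).u := fun r => by simp [f, hr]
    have exists_eq : ∀ r : Fin S.bound, (r : ℕ) < rows (S.lev γ) → ∃ i, r = (g i).r :=
      fun r h => ⟨⟨r, h⟩, Fin.ext (hr ⟨r, h⟩).symm⟩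
    refine not_isRowSwitch_twist_empty (f := f) hrows hP
      ⟨fun r h => ?_, fun r s hrs h h' _ _ => ?_⟩
    · obtain ⟨i, rfl⟩ := exists_eq r h
      rw [f_eq, Sum.inl.inj (hy i)]
      exact (g i).row
    · obtain ⟨i, rfl⟩ := exists_eq r h
      obtain ⟨j, rfl⟩ := exists_eq s h'
      have hij := hadj i j fun h => hrs (h ▸ rfl)
      rw [hg, hg, adj_inr_inr_of_ne (Sum.inl.inj ((hx i).symm.trans (hx j)))
        (Sum.inl.inj ((hy i).symm.trans (hy j))) (Fin.ext ((ht i).trans (ht j).symm)) hrs,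
        ← Sum.inl.inj (hx i), ← Sum.inl.inj (hy i), ht] at hij
      simpa only [f_eq, hb] using hij

end Skeleton

/-! ### Uniform definability of the information -/

/-- Uniform first-order definability in the graphs of a sequence of skeletons, up to finitely many
exceptions. -/
abbrev Skeleton.Definable {roles rows : ℕ → ℕ} (S : ℕ → Skeleton roles rows)
    (b : (n : ℕ) → (S n).B → (S n).B → ℕ → Prop) {α : Type}
    (ρ : (n : ℕ) → (α → (S n).Vertex) → Prop) : Prop :=
  DefinableAlong Filter.atTop (fun n => (S n).graph (b n)) ρ

namespace Skeleton.Definable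

variable {roles rows : ℕ → ℕ} {S : ℕ → Skeleton roles rows}
  {b : (n : ℕ) → (S n).B → (S n).B → ℕ → Prop} {α : Type}

theorem adj (s t : α) : Definable S b fun n a => (S n).Adj (b n) (a s) (a t) :=
  DefinableAlong.adj s t

theorem isLabel (s : α) : Definable S b fun n a => (S n).IsLabel (a s) :=
  (adj s s).not.congr fun n a => by rw [adj_self_iff, not_not]

theorem isPoint (s : α) : Definable S b fun n a => (S n).IsPoint (a s) :=
  ((adj s s).and (.all ((adj (Sum.inl s) (Sum.inr ())).imp (adj (Sum.inr ()) (Sum.inr ()))))).congr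
    fun n a => (isPoint_iff (b n) (a s)).symm

theorem isGadget (s : α) : Definable S b fun n a => (S n).IsGadget (a s) :=
  ((adj s s).and (isPoint s).not).congr fun n a => (isGadget_iff (b n) (a s)).symm

theorem eq_coord (c : Fin 3) (s t : α) :
    Definable S b fun n a => a t = Sum.inl ((S n).coord (a s) c) := by
  have of_point : Definable S b fun n a => ¬ (S n).IsGadget (a s) ∧ a t = a s :=
    (isGadget s).not.and (.eq t s)
  match c with
  | 0 =>
    exact (of_point.or ((isGadget s).and ((isGadget t).not.and (adj t s)))).congr
      fun n a => (eq_coord_zero_iff (b n) (a s) (a t)).symm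
  | 1 =>
    exact (of_point.or ((isGadget s).and ((isPoint t).and (adj s t)))).congr
      fun n a => (eq_coord_one_iff (b n) (a s) (a t)).symm
  | 2 =>
    exact (of_point.or ((isGadget s).and ((isLabel t).and (adj s t)))).congr
      fun n a => (eq_coord_two_iff (b n) (a s) (a t)).symm

theorem subst_coord {τ : (n : ℕ) → (α → (S n).Vertex) → (S n).Vertex → Prop} (c : Fin 3) (s : α)
    (h : Definable S b fun n (a : α ⊕ Unit → (S n).Vertex) =>
      τ n (fun i => a (Sum.inl i)) (a (Sum.inr ()))) :
    Definable S b fun n a => τ n a (Sum.inl ((S n).coord (a s) c)) :=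
  (DefinableAlong.ex (τ := fun n a w => w = Sum.inl ((S n).coord (a s) c) ∧ τ n a w)
    ((eq_coord c (Sum.inl s) (Sum.inr ())).and h)).congr fun _ _ => exists_eq_left

theorem eq_coord_coord (s : α) (c : Fin 3) (s' : α) (c' : Fin 3) :
    Definable S b fun n a => (S n).coord (a s) c = (S n).coord (a s') c' :=
  (subst_coord (τ := fun n a w => w = Sum.inl ((S n).coord (a s') c')) c s
    (eq_coord c' (Sum.inl s') (Sum.inr ()))).congr fun _ _ => Sum.inl_injective.eq_iff

theorem eq_lab_diff (s s' t : α) :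
    Definable S b fun n a => a t = Sum.inl ((S n).lab ((S n).diff (b n) (a s) (a s'))) := by
  have distinguished : Definable S b fun n (a : α ⊕ Unit → (S n).Vertex) =>
      ∃ z, (S n).IsGadget z ∧ (S n).Adj (b n) z (a (Sum.inr ())) ∧
        ¬ ((S n).Adj (b n) z (a (Sum.inl s)) ↔ (S n).Adj (b n) z (a (Sum.inl s'))) :=
    .ex ((isGadget (Sum.inr ())).and ((adj (Sum.inr ()) (Sum.inl (Sum.inr ()))).and
      ((adj (Sum.inr ()) (Sum.inl (Sum.inl s))).iff (adj (Sum.inr ()) (Sum.inl (Sum.inl s')))).not))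
  exact ((isLabel t).and (.all ((isLabel (Sum.inr ())).imp
    ((adj (Sum.inr ()) (Sum.inl t)).iff distinguished)))).congr
      fun n a => (eq_lab_diff_iff (b n) (a s) (a s') (a t)).symm

theorem _root_.Skeleton.eventually_lt_two_pow_bits (hS : ∀ n, n ≤ (S n).bits) (c : ℕ) :
    ∀ᶠ n in Filter.atTop, c < 2 ^ (S n).bits :=
  Filter.eventually_atTop.2 ⟨c, fun n hn => (hn.trans (hS n)).trans_lt (S n).bits_lt_two_pow⟩

theorem eq_lab (hS : ∀ n, n ≤ (S n).bits) (c : ℕ) {α : Type} (s : α) :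
    Definable S b fun n a => a s = Sum.inl ((S n).lab c) := by
  induction c using Nat.strong_induction_on generalizing α with
  | _ c ih =>
    have digit : Definable S b fun n (a : α ⊕ Unit → (S n).Vertex) =>
        ∃ d : Fin c, c.testBit d = true ∧ a (Sum.inr ()) = Sum.inl ((S n).lab d) :=
      .exists_finite fun d => .and (.const _) (ih d d.2 (Sum.inr ()))
    have digits : Definable S b fun n (a : α → (S n).Vertex) => ∀ v, (S n).IsLabel v →
        ((S n).Adj (b n) v (a s) ↔ ∃ d : Fin c, c.testBit d = true ∧ v = Sum.inl ((S n).lab d)) :=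
      .all ((isLabel (Sum.inr ())).imp ((adj (Sum.inr ()) (Sum.inl s)).iff digit))
    refine ((isLabel s).and digits).congr_eventually ?_
    filter_upwards [eventually_lt_two_pow_bits hS c] with n hn a
    rw [eq_lab_iff_adj (b n) hn]
    refine and_congr_right fun _ => forall_congr' fun v => imp_congr_right fun _ =>
      iff_congr Iff.rfl ⟨fun ⟨d, hd⟩ => ⟨d, hd⟩, fun ⟨d, hd, hv⟩ => ⟨⟨d, ?_⟩, hd, hv⟩⟩
    exact Nat.lt_two_pow_self.trans_le (Nat.ge_two_pow_of_testBit hd)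

variable (hS : ∀ n, n ≤ (S n).bits)
include hS

theorem isLevelOf (s t : α) : Definable S b fun n a => (S n).IsLevelOf (a s) (a t) :=
  (((isLabel s).and (eq_lab hS 0 t)).or
    ((isPoint s).and ((isLabel t).and (adj t s)))).congr
      fun n a => (isLevelOf_iff (b n) (a s) (a t)).symm

theorem lev_eq (l : ℕ) (s : α) :
    Definable S b fun n a => ∃ β, a s = Sum.inl β ∧ (S n).lev β = l := by
  have h : Definable S b fun n (a : α → (S n).Vertex) =>
      ∃ w, (S n).IsLevelOf (a s) w ∧ w = Sum.inl ((S n).lab l) :=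
    .ex ((isLevelOf hS (Sum.inl s) (Sum.inr ())).and (eq_lab hS l (Sum.inr ())))
  refine h.congr_eventually ?_
  filter_upwards [eventually_lt_two_pow_bits hS l] with n hn a
  constructor
  · rintro ⟨_, ⟨β, hβ, rfl⟩, hw⟩
    exact ⟨β, hβ, (S n).lab_inj ((S n).lev_lt_two_pow β) hn (Sum.inl.inj hw)⟩
  · rintro ⟨β, hβ, rfl⟩
    exact ⟨_, ⟨β, hβ, rfl⟩, rfl⟩

theorem lev_lt (l : ℕ) (s : α) : Definable S b fun n a => ∃ β, a s = Sum.inl β ∧ (S n).lev β < l :=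
  (DefinableAlong.exists_finite fun i : Fin l => lev_eq hS i s).congr fun _ _ =>
    ⟨fun ⟨i, β, hβ, hi⟩ => ⟨β, hβ, hi ▸ i.2⟩, fun ⟨β, hβ, hi⟩ => ⟨⟨_, hi⟩, β, hβ, rfl⟩⟩

open Classical in
theorem eq_lab_ite {p : (n : ℕ) → (α → (S n).Vertex) → Prop} (hp : Definable S b p) (t : α) :
    Definable S b fun n a => a t = Sum.inl ((S n).lab (if p n a then 1 else 0)) :=
  ((hp.and (eq_lab hS 1 t)).or (hp.not.and (eq_lab hS 0 t))).congr fun n a => by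
    by_cases h : p n a <;> simp [h]

theorem eq_info (l : ℕ) {m : ℕ} (o : Slot m) (g : Fin m → α) (t : α) :
    Definable S b fun n a => a t = Sum.inl ((S n).info (b n) l (fun i => a (g i)) o) := by
  cases o with
  | unit => exact eq_lab hS 0 t
  | level s c =>
    refine (subst_coord (τ := fun n a w => (S n).IsLevelOf w (a t)) c (g s)
      (isLevelOf hS (Sum.inr ()) (Sum.inl t))).congr fun n a => ?_
    simp [IsLevelOf, info]
  | low s c =>
    refine (subst_coord (τ := fun n a w => ((∃ β, w = Sum.inl β ∧ (S n).lev β < l) ∧ a t = w) ∨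
        (¬ (∃ β, w = Sum.inl β ∧ (S n).lev β < l) ∧ a t = Sum.inl ((S n).lab 0))) c (g s)
      (((lev_lt hS l (Sum.inr ())).and (.eq (Sum.inl t) (Sum.inr ()))).or
        ((lev_lt hS l (Sum.inr ())).not.and (eq_lab hS 0 (Sum.inl t))))).congr fun n a => ?_
    by_cases hl : (S n).lev ((S n).coord (a (g s)) c) < l <;> simp [info, hl]
  | eq s c s' c' => exact eq_lab_ite hS (eq_coord_coord (g s) c (g s') c') t
  | adj s s' => exact eq_lab_ite hS (adj (g s) (g s')) t
  | diff s s' => exact eq_lab_diff (g s) (g s') t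

theorem isInRow (v x y : α) (t r : ℕ) :
    Definable S b fun n a => (S n).IsInRow (a v) (a x) (a y) t r := by
  have hlab : Definable S b fun n a => (S n).coord (a v) 2 = (S n).lab (Nat.pair t r) :=
    (subst_coord (τ := fun n _ w => w = Sum.inl ((S n).lab (Nat.pair t r))) 2 v
      (eq_lab hS _ (Sum.inr ()))).congr fun _ _ => Sum.inl_injective.eq_iff
  refine ((isGadget v).and ((eq_coord 0 v x).and ((eq_coord 1 v y).and hlab))).congr_eventually ?_
  filter_upwards [eventually_lt_two_pow_bits hS (Nat.pair t r)] with n hn a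
  exact (isInRow_iff _ _ _ hn).symm

theorem twisted {l t : ℕ} (ht : t < roles l) (hrows : 2 ≤ rows l) (x y : α) :
    Definable S b fun n a => ∃ β γ, a x = Sum.inl β ∧ a y = Sum.inl γ ∧ (S n).lev β < l ∧
      (S n).lev γ = l ∧ b n β γ t := by
  have clique : Definable S b fun n (a : α → (S n).Vertex) => ∃ z : Fin (rows l) → (S n).Vertex,
      (∀ r, (S n).IsInRow (z r) (a x) (a y) t r) ∧
        ∀ r s, r ≠ s → (S n).Adj (b n) (z r) (z s) :=
    .exists_tuple (.and
      (.forall_finite fun r => isInRow hS (Sum.inr r) (Sum.inl x) (Sum.inl y) t r)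
      (.forall_finite fun r => .forall_finite fun s =>
        .imp (.const _) (adj (Sum.inr r) (Sum.inr s))))
  refine (((lev_lt hS l x).and (lev_eq hS l y)).and clique.not).congr fun n a => ?_
  constructor
  · rintro ⟨⟨⟨β, hβ, hβl⟩, γ, hγ, hγl⟩, hz⟩
    rw [hβ, hγ, ← not_twisted_iff (b n) hβl hγl ht hrows, not_not] at hz
    exact ⟨β, γ, hβ, hγ, hβl, hγl, hz⟩
  · rintro ⟨β, γ, hβ, hγ, hβl, hγl, hb⟩
    refine ⟨⟨⟨β, hβ, hβl⟩, γ, hγ, hγl⟩, ?_⟩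
    rwa [hβ, hγ, ← not_twisted_iff (b n) hβl hγl ht hrows, not_not]

end Skeleton.Definable

/-! ### Graphs that store the truth tables of queries -/

/-- The index of a piece of information, as the role of the entry that codes it. -/
noncomputable def Slot.role {m : ℕ} (o : Slot m) : ℕ := Finite.equivFin (Slot m) o

theorem Slot.role_injective {m : ℕ} : Function.Injective (Slot.role (m := m)) :=
  fun _ _ h => (Finite.equivFin _).injective (Fin.ext h)

section Tables

variable (q : ℕ → PebbleQuery)

/-- The number of roles on level `l`: one for each piece of information about the arguments of the
query `q l`. -/
noncomputable def queryRoles (l : ℕ) : ℕ := Nat.card (Slot (q l).arity)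

/-- The number of rows of the gadgets of level `l`: more than the queries `q i` with `i ≤ l` can
look at simultaneously. -/
def queryRows (l : ℕ) : ℕ := 2 + ∑ i ∈ Finset.range (l + 1), ((q i).arity + (q i).width)

theorem lt_queryRows {l i : ℕ} (h : l ≤ i) :
    (q l).arity < queryRows q i ∧ (q l).width < queryRows q i := by
  have := Finset.single_le_sum (f := fun i => (q i).arity + (q i).width)
    (fun _ _ => Nat.zero_le _) (Finset.mem_range.2 (Nat.lt_add_one_iff.2 h))
  unfold queryRows
  omega

theorem two_le_queryRows (l : ℕ) : 2 ≤ queryRows q l := Nat.le_add_right _ _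

variable {q} {l : ℕ}

theorem Slot.role_lt (o : Slot (q l).arity) : o.role < queryRoles q l :=
  (Finite.equivFin _ o).2

theorem Slot.exists_role_eq {t : ℕ} (ht : t < queryRoles q l) :
    ∃ o : Slot (q l).arity, o.role = t :=
  ⟨(Finite.equivFin _).symm ⟨t, ht⟩, by simp [Slot.role]⟩

namespace Skeleton

variable (S : Skeleton (queryRoles q) (queryRows q))

/-- The truth table of the query `q l`: it holds for some tuple with the information `v`, in some
graph that agrees with `b` below level `l`. -/
def Table (b : S.B → S.B → ℕ → Prop) (l : ℕ) (v : ℕ → S.B) : Prop :=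
  ∃ b' : S.B → S.B → ℕ → Prop, (∀ x y t, S.lev y < l → (b x y t ↔ b' x y t)) ∧
    ∃ a : Fin (q l).arity → S.Vertex, (∀ o, S.info b' l a o = v o.role) ∧ (q l).rel (S.graph b') a

theorem table_congr {b c : S.B → S.B → ℕ → Prop}
    (h : ∀ x y t, S.lev y < l → (b x y t ↔ c x y t)) (v : ℕ → S.B) :
    S.Table b l v ↔ S.Table c l v :=
  exists_congr fun _ => and_congr_left fun _ => forall₄_congr fun x y t hy =>
    iff_congr (h x y t hy) Iff.rfl

/-- The twists of the gadgets of level below `l`: the gadget `(x, y, t)` is twisted if `x` is the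
entry of `y` with role `t` and the tuple that `y` codes belongs to the truth table of its level. -/
def twistsBelow : ℕ → S.B → S.B → ℕ → Prop
  | 0, _, _, _ => False
  | l + 1, x, y, t => (S.lev y = l ∧ S.levels.dec y t = x ∧
      S.Table (twistsBelow l) l (S.levels.dec y)) ∨ (S.lev y ≠ l ∧ twistsBelow l x y t)

/-- The twists of all gadgets. -/
def twists (x y : S.B) (t : ℕ) : Prop := S.twistsBelow (S.lev y + 1) x y t

theorem twistsBelow_iff {x y : S.B} {t : ℕ} (h : S.lev y < l) :
    S.twistsBelow l x y t ↔ S.twists x y t := by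
  induction l with
  | zero => exact absurd h (Nat.not_lt_zero _)
  | succ l ih =>
    by_cases hl : S.lev y = l
    · rw [twists, hl]
    · rw [← ih (by omega)]
      simp [twistsBelow, hl]

theorem twists_iff {x y : S.B} {t : ℕ} :
    S.twists x y t ↔ S.levels.dec y t = x ∧ S.Table S.twists (S.lev y) (S.levels.dec y) := by
  rw [← S.table_congr fun x y t hy => S.twistsBelow_iff hy]
  simp [twists, twistsBelow]

theorem rel_iff_exists_twists (hl : 0 < l) (hlS : l ≤ S.height)
    (a : Fin (q l).arity → S.Vertex) :
    (q l).rel (S.graph S.twists) a ↔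
      ∃ y, S.lev y = l ∧ ∀ o, S.twists (S.info S.twists l a o) y o.role := by
  constructor
  · intro ha
    obtain ⟨v, hv⟩ : ∃ v : ℕ → S.B, ∀ o : Slot (q l).arity, v o.role = S.info S.twists l a o :=
      ⟨Function.extend Slot.role (S.info S.twists l a) fun _ => S.lab 0,
        fun o => Slot.role_injective.extend_apply _ _ o⟩
    have hlow : ∀ t < queryRoles q l, S.lev (v t) < l := by
      intro t ht
      obtain ⟨o, rfl⟩ := Slot.exists_role_eq ht
      exact hv o ▸ S.lev_info_lt _ hl _ _
    obtain ⟨y, rfl, hy⟩ := S.levels.exists_dec l hl hlS v hlow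
    have hdec : ∀ o : Slot (q (S.lev y)).arity,
        S.levels.dec y o.role = S.info S.twists (S.lev y) a o :=
      fun o => (hy _ o.role_lt).trans (hv o)
    exact ⟨y, rfl, fun o => S.twists_iff.2 ⟨hdec o,
      S.twists, fun _ _ _ _ => Iff.rfl, a, fun o => (hdec o).symm, ha⟩⟩
  · rintro ⟨y, rfl, hy⟩
    obtain ⟨b', hb', a', ha', hrel⟩ := (S.twists_iff.1 (hy .unit)).2
    refine (rel_iff_of_info_eq (q (S.lev y)) hl (fun i hi _ => lt_queryRows q hi) hb' ?_).2 hrel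
    funext o
    rw [ha' o, (S.twists_iff.1 (hy o)).1]

theorem Definable.rel {S : ℕ → Skeleton (queryRoles q) (queryRows q)}
    (hS : ∀ n, (S n).height = n) (hl : 0 < l) :
    Definable S (fun n => (S n).twists) fun n => (q l).rel ((S n).graph (S n).twists) := by
  have hbits : ∀ n, n ≤ (S n).bits := fun n => ((hS n).symm.trans_lt (S n).height_lt).le
  have h : Definable S (fun n => (S n).twists)
      fun n (a : Fin (q l).arity → (S n).Vertex) => ∃ v : Slot (q l).arity → (S n).Vertex,
        (∀ o, v o = Sum.inl ((S n).info (S n).twists l a o)) ∧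
        ∃ w : (S n).Vertex, ∀ o, ∃ β γ, v o = Sum.inl β ∧ w = Sum.inl γ ∧ (S n).lev β < l ∧
          (S n).lev γ = l ∧ (S n).twists β γ o.role :=
    .exists_tuple (.and (.forall_finite fun o => eq_info hbits l o Sum.inl (Sum.inr o))
      (.ex (.forall_finite fun o => twisted hbits o.role_lt (two_le_queryRows q l)
        (Sum.inl (Sum.inr o)) (Sum.inr ()))))
  refine h.congr_eventually ?_
  filter_upwards [Filter.eventually_ge_atTop l] with n hn a
  rw [(S n).rel_iff_exists_twists hl (hn.trans (hS n).ge)]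
  constructor
  · rintro ⟨v, hv, w, hw⟩
    obtain ⟨_, γ, -, rfl, -, hγ, -⟩ := hw .unit
    refine ⟨γ, hγ, fun o => ?_⟩
    obtain ⟨β, γ', hβ, hγ', -, -, ht⟩ := hw o
    rw [hv o] at hβ
    rwa [Sum.inl.inj hβ, Sum.inl.inj hγ']
  · rintro ⟨y, hy, ht⟩
    exact ⟨_, fun o => rfl, .inl y, fun o =>
      ⟨_, y, rfl, rfl, (S n).lev_info_lt _ hl a o, hy, ht o⟩⟩

end Skeleton

end Tables

/-! ### Unbounded inductions -/

/-- The formula `∀ y, E y v → ¬ E y y → P y`. -/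
def accessibleFormula : (graphPredLang 1).Formula (Fin 1 ⊕ Fin 0) :=
  .all (.imp (.rel (n := 1) (GraphPredRel.adj : (graphPredLang 1).Relations 2)
      ![.var (.inr 0), .var (.inl (.inl 0))])
    (.imp (.imp (.rel (GraphPredRel.adj : (graphPredLang 1).Relations 2)
      ![.var (.inr 0), .var (.inr 0)]) .falsum)
      (.rel (GraphPredRel.pred : (graphPredLang 1).Relations 1) ![.var (.inr 0)])))

theorem predPolarity_accessibleFormula : PredPolarity true accessibleFormula := by
  simp [accessibleFormula, PredPolarity, GraphPredRel.Allowed]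

theorem mem_stage_succ_accessibleFormula (G : FinDigraph) (a : Fin 0 → G.V) (i : ℕ)
    (v : Fin 1 → G.V) :
    v ∈ G.stage accessibleFormula a (i + 1) ↔ ∀ y, G.graph.Adj y (v 0) → ¬ G.graph.Adj y y →
      (fun _ => y) ∈ G.stage accessibleFormula a i := by
  rw [FinDigraph.stage, Function.iterate_succ_apply']
  change (∀ y : G.V, (G.graph.Adj _ _ → (G.graph.Adj _ _ → False) → _ ∈ _)) ↔ _
  refine forall_congr' fun y => imp_congr Iff.rfl (imp_congr Iff.rfl ?_)
  refine Eq.to_iff (congrArg (· ∈ G.stage accessibleFormula a i) ?_)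
  funext j
  rw [Subsingleton.elim j 0]
  rfl

/-- The numbers `0, 1, 2, 4, 16, …`: the only binary digit `1` of an entry is at the place given by
the preceding entry. -/
def tower : ℕ → ℕ
  | 0 => 0
  | k + 1 => 2 ^ tower k

namespace Skeleton

variable {roles rows : ℕ → ℕ} {S : Skeleton roles rows} (b : S.B → S.B → ℕ → Prop)
  (a : Fin 0 → S.Vertex)

theorem lab_mem_stage_succ_iff {d : ℕ} (hd : d < 2 ^ S.bits) (i : ℕ) :
    (fun _ => .inl (S.lab d)) ∈ (S.graph b).stage accessibleFormula a (i + 1) ↔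
      ∀ s, d.testBit s = true →
        (fun _ => .inl (S.lab s)) ∈ (S.graph b).stage accessibleFormula a i := by
  rw [mem_stage_succ_accessibleFormula]
  have hadj := ((eq_lab_iff_adj b hd _).1 rfl).2
  constructor
  · intro h s hs
    exact h _ ((hadj _ (isLabel_lab s)).2 ⟨s, hs, rfl⟩)
      fun hss => (adj_self_iff b _).1 hss (isLabel_lab s)
  · intro h y hy hyy
    obtain ⟨s, hs, rfl⟩ := (hadj y (not_not.1 fun hlab => hyy ((adj_self_iff b y).2 hlab))).1 hy
    exact h s hs

theorem lab_tower_mem_stage_iff {k : ℕ} (hk : tower k < 2 ^ S.bits) (i : ℕ) :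
    (fun _ => .inl (S.lab (tower k))) ∈ (S.graph b).stage accessibleFormula a i ↔ k < i := by
  induction i generalizing k with
  | zero => exact iff_of_false (fun h => h) (Nat.not_lt_zero k)
  | succ i ih =>
    rw [lab_mem_stage_succ_iff b a hk]
    cases k with
    | zero => simp [tower]
    | succ k =>
      simp only [tower, Nat.testBit_two_pow, decide_eq_true_eq, forall_eq']
      rw [ih (Nat.lt_two_pow_self.trans hk), Nat.succ_lt_succ_iff]

theorem admitsUnboundedFixedPoints {S : ℕ → Skeleton roles rows} (hS : ∀ n, n ≤ (S n).bits)
    (b : (n : ℕ) → (S n).B → (S n).B → ℕ → Prop) :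
    AdmitsUnboundedFixedPoints (Set.range fun n => (S n).graph (b n)) := by
  refine ⟨1, 0, accessibleFormula, predPolarity_accessibleFormula, ?_⟩
  rintro ⟨j, hj⟩
  have hlt : tower j < 2 ^ (S (tower j)).bits :=
    (hS _).trans_lt (S (tower j)).bits_lt_two_pow
  have hmem := lab_tower_mem_stage_iff (b (tower j)) Fin.elim0 hlt
  refine (lt_irrefl j) ((hmem j).1 ?_)
  rw [hj _ ⟨tower j, rfl⟩]
  exact Set.mem_iUnion.2 ⟨j + 1, (hmem (j + 1)).2 j.lt_succ_self⟩

end Skeleton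

theorem exists_admitsUnboundedFixedPoints_forall_foExpressibleOn {Q : Set PebbleQuery}
    (hQ : Q.Countable) :
    ∃ J : ℕ → FinDigraph, AdmitsUnboundedFixedPoints (Set.range J) ∧
      ∀ q ∈ Q, FOExpressibleOn (Set.range J) q.rel := by
  let trivialQuery : PebbleQuery := ⟨0, 0, fun _ _ => True, fun _ _ _ _ _ _ _ => Iff.rfl⟩
  obtain ⟨q, hq⟩ := (hQ.insert trivialQuery).exists_eq_range (Set.insert_nonempty _ _)
  choose S hS using
    Skeleton.exists_height (queryRoles fun l => q (l - 1)) (queryRows fun l => q (l - 1))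
  refine ⟨fun n => (S n).graph (S n).twists, Skeleton.admitsUnboundedFixedPoints
    (fun n => ((hS n).symm.trans_lt (S n).height_lt).le) _, fun p hp => ?_⟩
  obtain ⟨i, rfl⟩ : p ∈ Set.range q := hq ▸ Set.mem_insert_of_mem _ hp
  exact (q i).foExpressibleOn_range (Skeleton.Definable.rel (q := fun l => q (l - 1)) hS i.succ_pos)

theorem mainTheorem3 :
    (∃ J : ℕ → FinDigraph,
      AdmitsUnboundedFixedPoints (Set.range J) ∧
      ∀ (m : ℕ) (φ : FPCFormula m), FOExpressibleOn (Set.range J) φ.Realize) ∧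
    (∀ S : Set LCountFormula.{u}, S.Countable →
      ∃ J : ℕ → FinDigraph,
        AdmitsUnboundedFixedPoints (Set.range J) ∧
        ∀ φ ∈ S, FOExpressibleOn (Set.range J) φ.Realize) := by
  constructor
  · obtain ⟨J, hJ, hexpr⟩ := exists_admitsUnboundedFixedPoints_forall_foExpressibleOn
      (Set.countable_range fun φ : Σ m, FPCFormula m => φ.2.toPebbleQuery)
    exact ⟨J, hJ, fun m φ => hexpr φ.toPebbleQuery ⟨⟨m, φ⟩, rfl⟩⟩
  · intro S hS
    obtain ⟨J, hJ, hexpr⟩ := exists_admitsUnboundedFixedPoints_forall_foExpressibleOn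
      (hS.image LCountFormula.toPebbleQuery)
    exact ⟨J, hJ, fun φ hφ => hexpr _ (Set.mem_image_of_mem _ hφ)⟩
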